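/- Let $p\ge 2$ and $n\ge 0$ be integers and let $q$ be an indeterminate. For $l\ge 1$ put $[p]_l=\frac{1-q^{2pl}}{1-q^{2l}}=\sum_{s=0}^{p-1}q^{2ls}$. For a partition $\lambda$ let $m_i(\lambda)$ be the multiplicity of $i$ as a part of $\lambda$. Let $P(d)$ be the set of partitions of $d$, let $P_{(p)}(n)$ be the set of partitions of $n$ with no part divisible by $p$, and let $c_p(d)$ be the number of $p$-cores of size $d$, i.e. of partitions of $d$ with no hook of length $p$. Set $$A_j(d)=\sum_{\lambda\in P(d)}\frac{m_j(\lambda)}{p-1}\prod_{i\ge1}\binom{p-2+m_i(\lambda)}{m_i(\lambda)}$$ (a nonnegative integer), and $$\Delta_{p,n}=\prod_{0\le d\le\lfloor n/p\rfloor}\Bigl(\prod_{j\ge1}[p]_j^{A_j(d)}\Bigr)^{c_p(n-pd)} .$$ For $\lambda\in P_{(p)}(n)$ let $g_i$ be the operation, allowed when $i$ has multiplicity at least $p$, that replaces $p$ parts equal to $i$ by one part $pi$. Apply such operations to $\lambda$ until all multiplicities are less than $p$, let $d_i(\lambda)$ be the number of times $g_i$ occurs (this does not depend on the order chosen), and put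 $w_G(\lambda)=\prod_{i\ge1}[p]_i^{d_i(\lambda)}$. For $k=ap^b\ge 1$ with $p\nmid a$ put $(k)_{[p]}=\prod_{s=0}^{b-1}[p]_{ap^s}$, and put $w_E(\lambda)=\prod_{i\ge1,\,p\nmid i}\prod_{j=1}^{m_i(\lambda)}(j)_{[p]}$. Let $\mathfrak D(n)$ be the finite set of all $(\lambda;i,j,k)$ with $\lambda\in P_{(p)}(n)$, $i\ge 1$, $p\nmid i$, $j\ge0$, $1\le k\le\lfloor m_i(\lambda)/p\rfloor$ and $p^j\mid k$. For $c=(\lambda;i,j,k)\in\mathfrak D(n)$ put $G(c)=ip^j$ and $E(c)=k/p^j$. Then, as polynomials in $q$, $$\Delta_{p,n}=\prod_{\lambda\in P_{(p)}(n)}w_G(\lambda)=\prod_{\lambda\in P_{(p)}(n)}w_E(\lambda).$$ Moreover $$\prod_{\lambda\in P_{(p)}(n)}w_G(\lambda)=\prod_{c\in\mathfrak D(n)}[p]_{G(c)},\qquad \prod_{\lambda\in P_{(p)}(n)}w_E(\lambda)=\prod_{c\in\mathfrak D(n)}[p]_{E(c)},$$ and there is an involution $\theta:\mathfrak D(n)\to\mathfrak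 D(n)$ with $E\circ\theta=G$, given as follows. For $c=(\lambda;i,j,k)\in\mathfrak D(n)$ write $k=i'p^{j+j'}$ with $p\nmid i'$ and $j'\ge 0$, and let $\mu$ be the partition obtained from $\lambda$ by removing $pk$ parts equal to $i$. Then $\theta(c)=(\mu+(i'^{\,pk'});\,i',j',k')$ with $k'=ip^{j+j'}$, where $\mu+(i'^{\,pk'})$ is obtained from $\mu$ by adding $pk'$ parts equal to $i'$. -/

import Mathlib

open Polynomial

noncomputable section

namespace GradedCartan

/-! ### Partitions, class regular partitions, cores -/

/-- The multiplicity `m_i(lam)` of `i` as a part of the partition `lam`. -/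
def mult {n : ℕ} (lam : n.Partition) (i : ℕ) : ℕ := lam.parts.count i

/-- The set of `p`-class regular partitions of `n`: no part is divisible by `p`. -/
def classRegular (p n : ℕ) : Finset n.Partition := Nat.Partition.restricted n (fun i => ¬ p ∣ i)

/-- The Young diagram of a partition; its row lengths are the parts in weakly decreasing order. -/
def youngDiagram {n : ℕ} (lam : n.Partition) : YoungDiagram :=
  YoungDiagram.ofRowLens (lam.parts.sort (· ≥ ·))
    (Multiset.pairwise_sort lam.parts (· ≥ ·)).sortedGE

/-- The hook length of a cell `c = (i, j)` (row `i`, column `j`, counted from `0`) of a Young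
diagram: arm length plus leg length plus one. -/
def hookLength (Y : YoungDiagram) (c : ℕ × ℕ) : ℕ :=
  (Y.rowLen c.1 - (c.2 + 1)) + (Y.colLen c.2 - (c.1 + 1)) + 1

/-- A partition is a `p`-core if its diagram has no `p`-hook, i.e. no hook of length `p`. -/
def IsCore (p : ℕ) {n : ℕ} (lam : n.Partition) : Prop :=
  ∀ c ∈ youngDiagram lam, hookLength (youngDiagram lam) c ≠ p

open Classical in
/-- The number `c_p(d)` of `p`-cores among the partitions of `d`. -/
def coreCount (p d : ℕ) : ℕ := (Finset.univ.filter fun lam : d.Partition => IsCore p lam).card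

/-! ### `q`-integers; the indeterminate `q` is `X` -/

/-- `[p]_l = 1 + q^(2l) + ... + q^(2l(p-1))`, the `q`-integer of `p` with base `q^(2l)`. -/
def qInt (p l : ℕ) : ℤ[X] := ∑ s ∈ Finset.range p, X ^ (2 * l * s)

/-- For `l ≥ 1` this is the polynomial `(1 - q^(2pl)) / (1 - q^(2l))`. -/
theorem qInt_mul (p l : ℕ) : qInt p l * (1 - X ^ (2 * l)) = 1 - X ^ (2 * p * l) := by
  have h := geom_sum_mul_neg (X ^ (2 * l) : ℤ[X]) p
  simp only [← pow_mul] at h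
  rw [qInt, h]
  congr 2
  ring

/-- The graded `p`-part of `k ≥ 1`: if `k = a p^b` with `p ∤ a`, it is the product of
`[p]_(a p^s)` for `0 ≤ s < b`. -/
def gradedPart (p k : ℕ) : ℤ[X] :=
  ∏ s ∈ Finset.range (multiplicity p k), qInt p (k / p ^ multiplicity p k * p ^ s)

theorem gradedPart_eq {p : ℕ} (hp : 2 ≤ p) {a : ℕ} (ha : ¬ p ∣ a) (b : ℕ) :
    gradedPart p (a * p ^ b) = ∏ s ∈ Finset.range b, qInt p (a * p ^ s) := by
  have hb : multiplicity p (a * p ^ b) = b := by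
    apply multiplicity_eq_of_dvd_of_not_dvd (Dvd.intro_left a rfl)
    rw [pow_succ, mul_comm a]
    exact fun h => ha (Nat.dvd_of_mul_dvd_mul_left (by positivity) h)
  rw [gradedPart, hb, Nat.mul_div_cancel _ (by positivity)]

/-! ### The weight `w_E`

In the products below, indices `i > n` contribute the factor `1`, because they have multiplicity
zero in a partition of `n`. -/

/-- `w_E(lam)`, the product over `i ≥ 1` with `p ∤ i` of the graded `p`-parts of
`1, ..., m_i(lam)`. -/
def wE (p : ℕ) {n : ℕ} (lam : n.Partition) : ℤ[X] :=
  ∏ i ∈ (Finset.Icc 1 n).filter (fun i => ¬ p ∣ i),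
    ∏ j ∈ Finset.Icc 1 (mult lam i), gradedPart p j

/-! ### The Glaisher correspondence and the weight `w_G` -/

/-- The step `g_i`: `p` copies of the part `i` are replaced by one part `p * i`. -/
def glaisherStep (p i : ℕ) (s : Multiset ℕ) : Multiset ℕ :=
  p * i ::ₘ (s - Multiset.replicate p i)

/-- `GlaisherPath p s l t`: the list `l` of steps transforms `s` into `t`, where the step `g_i` is
only allowed when `i` has multiplicity at least `p`. -/
inductive GlaisherPath (p : ℕ) : Multiset ℕ → List ℕ → Multiset ℕ → Prop
  | nil (s : Multiset ℕ) : GlaisherPath p s [] s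
  | cons {s t : Multiset ℕ} {l : List ℕ} (i : ℕ) (hi : p ≤ s.count i)
      (h : GlaisherPath p (glaisherStep p i s) l t) : GlaisherPath p s (i :: l) t

/-- The list `l` of steps transforms `s` into a `p`-regular multiset of parts. -/
def IsGlaisherSequence (p : ℕ) (s : Multiset ℕ) (l : List ℕ) : Prop :=
  ∃ t, GlaisherPath p s l t ∧ ∀ i, t.count i < p

theorem count_glaisherStep (p i k : ℕ) (s : Multiset ℕ) :
    (glaisherStep p i s).count k =
      s.count k - (if k = i then p else 0) + (if k = p * i then 1 else 0) := by
  simp only [glaisherStep, Multiset.count_cons, Multiset.count_sub, Multiset.count_replicate,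
    eq_comm]

theorem card_glaisherStep {p : ℕ} (hp : 2 ≤ p) {i : ℕ} {s : Multiset ℕ} (hi : p ≤ s.count i) :
    (glaisherStep p i s).card < s.card := by
  have h1 : Multiset.replicate p i ≤ s := Multiset.le_count_iff_replicate_le.1 hi
  have h2 := Multiset.card_le_card h1
  rw [Multiset.card_replicate] at h2
  rw [glaisherStep, Multiset.card_cons, Multiset.card_sub h1, Multiset.card_replicate]
  omega

theorem exists_isGlaisherSequence {p : ℕ} (hp : 2 ≤ p) (s : Multiset ℕ) :
    ∃ l, IsGlaisherSequence p s l := by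
  induction hc : s.card using Nat.strong_induction_on generalizing s with
  | _ c ih =>
    by_cases h : ∃ i, p ≤ s.count i
    · obtain ⟨i, hi⟩ := h
      obtain ⟨l, t, hl, ht⟩ := ih _ (hc ▸ card_glaisherStep hp hi) _ rfl
      exact ⟨i :: l, t, .cons i hi hl, ht⟩
    · push Not at h
      exact ⟨[], s, .nil s, h⟩

theorem IsGlaisherSequence.perm {p : ℕ} (hp : 2 ≤ p) {s : Multiset ℕ} {l l' : List ℕ}
    (h : IsGlaisherSequence p s l) (h' : IsGlaisherSequence p s l') : l.Perm l' := by
  induction hc : s.card using Nat.strong_induction_on generalizing s l l' with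
  | _ c ih =>
    obtain ⟨t, hl, ht⟩ := h
    obtain ⟨t', hl', ht'⟩ := h'
    cases hl with
    | nil =>
      cases hl' with
      | nil => exact List.Perm.refl _
      | cons i hi _ => exact absurd (ht i) (by omega)
    | @cons _ _ A a ha hA =>
      cases hl' with
      | nil => exact absurd (ht' a) (by omega)
      | @cons _ _ B b hb hB =>
        have ca := card_glaisherStep hp ha
        have cb := card_glaisherStep hp hb
        by_cases hab : a = b
        · subst hab
          exact (ih _ (hc ▸ ca) ⟨t, hA, ht⟩ ⟨t', hB, ht'⟩ rfl).cons a
        · have ha' : p ≤ (glaisherStep p b s).count a := by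
            rw [count_glaisherStep, if_neg hab]; omega
          have hb' : p ≤ (glaisherStep p a s).count b := by
            rw [count_glaisherStep, if_neg (Ne.symm hab)]; omega
          have hcomm : glaisherStep p b (glaisherStep p a s)
              = glaisherStep p a (glaisherStep p b s) := by
            ext k
            simp only [count_glaisherStep]
            by_cases h1 : k = a
            · subst h1
              simp only [hab, if_true, if_false]
              omega
            · by_cases h2 : k = b
              · subst h2
                simp only [h1, if_true, if_false]
                omega
              · simp only [h1, h2, if_false]
                omega
          obtain ⟨C, t'', hC, ht''⟩ := exists_isGlaisherSequence hp
            (glaisherStep p b (glaisherStep p a s))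
          have e1 : A.Perm (b :: C) :=
            ih _ (hc ▸ ca) ⟨t, hA, ht⟩ ⟨t'', .cons b hb' hC, ht''⟩ rfl
          have e2 : B.Perm (a :: C) :=
            ih _ (hc ▸ cb) ⟨t', hB, ht'⟩ ⟨t'', .cons a ha' (hcomm ▸ hC), ht''⟩ rfl
          exact ((e1.cons a).trans (List.Perm.swap b a C)).trans (e2.symm.cons b)

open Classical in
/-- The number `d_i` of occurrences of the step `g_i` when the steps are applied until the
multiset of parts is `p`-regular (well defined by `glaisherCount_eq`). -/
def glaisherCount (p : ℕ) (s : Multiset ℕ) (i : ℕ) : ℕ :=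
  if h : ∃ l, IsGlaisherSequence p s l then h.choose.count i else 0

/-- The number of occurrences of `g_i` does not depend on the order of the steps. -/
theorem glaisherCount_eq {p : ℕ} (hp : 2 ≤ p) {s : Multiset ℕ} {l : List ℕ}
    (h : IsGlaisherSequence p s l) (i : ℕ) : glaisherCount p s i = l.count i := by
  have h' : ∃ l, IsGlaisherSequence p s l := ⟨l, h⟩
  rw [glaisherCount, dif_pos h']
  exact (IsGlaisherSequence.perm hp h'.choose_spec h).count_eq i

/-- The Glaisher weight `w_G(lam)`, the product over `i ≥ 1` of `[p]_i ^ d_i(lam)`. -/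
def wG (p : ℕ) {n : ℕ} (lam : n.Partition) : ℤ[X] :=
  ∏ i ∈ Finset.Icc 1 n, qInt p i ^ glaisherCount p lam.parts i

/-! ### Tsuchioka's expression -/

/-- `A_j(d)`, the sum over partitions `lam` of `d` of
`m_j(lam) / (p - 1) * ∏_{i ≥ 1} (p - 2 + m_i(lam)).choose (m_i(lam))`. -/
def tsuchiokaA (p j d : ℕ) : ℚ :=
  ∑ lam : d.Partition, (mult lam j : ℚ) / ((p : ℚ) - 1) *
    ∏ i ∈ Finset.Icc 1 d, ((p - 2 + mult lam i).choose (mult lam i) : ℚ)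

/-- For `p ≥ 2` the rational number `A_j(d)` is a nonnegative integer. -/
theorem floor_tsuchiokaA {p : ℕ} (hp : 2 ≤ p) (j d : ℕ) :
    ((⌊tsuchiokaA p j d⌋₊ : ℕ) : ℚ) = tsuchiokaA p j d := by
  suffices h : ∃ N : ℕ, (N : ℚ) = tsuchiokaA p j d by
    obtain ⟨N, hN⟩ := h
    rw [← hN, Nat.floor_natCast]
  have hp1 : (p : ℚ) - 1 ≠ 0 := by
    have : (2 : ℚ) ≤ p := by exact_mod_cast hp
    intro h
    linarith
  have key : ∀ lam : d.Partition, ∃ N : ℕ, (N : ℚ) = (mult lam j : ℚ) / ((p : ℚ) - 1) *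
      ∏ i ∈ Finset.Icc 1 d, ((p - 2 + mult lam i).choose (mult lam i) : ℚ) := by
    intro lam
    by_cases hj : mult lam j = 0
    · exact ⟨0, by simp [hj]⟩
    have hmem : j ∈ lam.parts := Multiset.count_ne_zero.1 hj
    have hjd : j ∈ Finset.Icc 1 d := Finset.mem_Icc.2
      ⟨lam.parts_pos hmem, by
        have := Multiset.le_sum_of_mem hmem
        rwa [lam.parts_sum] at this⟩
    obtain ⟨k, hk⟩ := Nat.exists_eq_succ_of_ne_zero hj
    have hch := Nat.choose_succ_right_eq (p - 2 + (k + 1)) k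
    have hsub : p - 2 + (k + 1) - k = p - 1 := by omega
    rw [hsub] at hch
    have hq : ((p - 2 + (k + 1)).choose (k + 1) : ℚ) * ((k : ℚ) + 1)
        = ((p - 2 + (k + 1)).choose k : ℚ) * ((p : ℚ) - 1) := by
      have := congrArg (Nat.cast (R := ℚ)) hch
      rw [Nat.cast_mul, Nat.cast_mul, Nat.cast_sub (by omega)] at this
      push_cast at this
      exact this
    refine ⟨(p - 2 + (k + 1)).choose k * ∏ i ∈ (Finset.Icc 1 d).erase j,
      (p - 2 + mult lam i).choose (mult lam i), ?_⟩
    rw [← Finset.mul_prod_erase _ _ hjd, hk, Nat.succ_eq_add_one]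
    push_cast
    rw [← mul_assoc]
    congr 1
    field_simp
    linarith
  choose N hN using key
  refine ⟨∑ lam, N lam, ?_⟩
  rw [tsuchiokaA]
  push_cast
  exact Finset.sum_congr rfl fun lam _ => hN lam

/-- `Δ_{p,n}(d)`, the product over `j ≥ 1` of `[p]_j ^ A_j(d)`; here `A_j(d) = 0` for `j > d`. The
exponent is `A_j(d)` itself as a natural number, see `floor_tsuchiokaA`. -/
def blockDelta (p d : ℕ) : ℤ[X] := ∏ j ∈ Finset.Icc 1 d, qInt p j ^ ⌊tsuchiokaA p j d⌋₊

/-- Tsuchioka's expression `Δ_{p,n}`, the product over `0 ≤ d ≤ ⌊n/p⌋` of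
`Δ_{p,n}(d) ^ c_p(n - p d)`. -/
def delta (p n : ℕ) : ℤ[X] :=
  ∏ d ∈ Finset.range (n / p + 1), blockDelta p d ^ coreCount p (n - p * d)

/-! ### Labelled diagrams -/

/-- The elements `(lam; i, j, k)` of `𝔇(n)`: `lam` is a `p`-class regular partition of `n`,
`p ∤ i`, and `(j, k)` is a box of the diagram `D_i(lam)`, that is
`1 ≤ k ≤ ⌊m_i(lam) / p⌋` and `p ^ j ∣ k`. -/
structure Box (p n : ℕ) where
  lam : n.Partition
  i : ℕ
  j : ℕ
  k : ℕ
  lam_mem : lam ∈ classRegular p n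
  not_dvd : ¬ p ∣ i
  one_le : 1 ≤ k
  le_div : k ≤ mult lam i / p
  pow_dvd : p ^ j ∣ k

/-- The labelling `G(lam; i, j, k) = i p^j`. -/
def Box.G {p n : ℕ} (c : Box p n) : ℕ := c.i * p ^ c.j

/-- The labelling `E(lam; i, j, k) = k / p^j`. -/
def Box.E {p n : ℕ} (c : Box p n) : ℕ := c.k / p ^ c.j

/-- `𝔇(n)` is a finite set, so that products over it are meaningful. -/
theorem Box.finite {p : ℕ} (hp : 2 ≤ p) (n : ℕ) : Finite (Box p n) := by
  have hcount : ∀ c : Box p n, c.i < n + 1 ∧ c.k < n + 1 ∧ c.j < n + 1 := by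
    intro c
    have h1 : c.k ≤ mult c.lam c.i := c.le_div.trans (Nat.div_le_self _ _)
    have h0 := c.one_le
    have hmem : c.i ∈ c.lam.parts := Multiset.count_pos.1 (lt_of_lt_of_le h0 h1)
    have h2 : c.i ≤ n := by
      have := Multiset.le_sum_of_mem hmem
      rwa [c.lam.parts_sum] at this
    have h3 : mult c.lam c.i ≤ n := by
      have e : mult c.lam c.i ≤ c.lam.parts.card := Multiset.count_le_card _ _
      have f : c.lam.parts.card • 1 ≤ c.lam.parts.sum :=
        Multiset.card_nsmul_le_sum fun x hx => c.lam.parts_pos hx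
      rw [c.lam.parts_sum] at f
      simp only [smul_eq_mul, mul_one] at f
      exact e.trans f
    have h4 : c.j < c.k :=
      lt_of_lt_of_le (Nat.lt_pow_self (by omega)) (Nat.le_of_dvd h0 c.pow_dvd)
    omega
  let f : Box p n → n.Partition × Fin (n + 1) × Fin (n + 1) × Fin (n + 1) := fun c =>
    (c.lam, ⟨c.i, (hcount c).1⟩, ⟨c.j, (hcount c).2.2⟩, ⟨c.k, (hcount c).2.1⟩)
  refine Finite.of_injective f ?_
  intro c c' h
  obtain ⟨lam, i, j, k, _, _, _, _, _⟩ := c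
  obtain ⟨lam', i', j', k', _, _, _, _, _⟩ := c'
  simp only [f, Prod.mk.injEq, Fin.mk.injEq] at h
  obtain ⟨rfl, rfl, rfl, rfl⟩ := h
  rfl

end GradedCartan

end

/-! Both products over class regular partitions are read off the same boxes. For p ∤ a, the step
g_(a p^b) occurs ⌊m_a / p^(b+1)⌋ times (`glaisherCount_mul_pow`), which is the number of k ≤ ⌊m_a /
p⌋ divisible by p^b; so w_G is the product of the labels G (`wG_eq`). In w_E only the multiples pk
of p contribute, and the graded part of pk is the product of [p]_(k/p^j) over p^j ∣ k; so w_E is the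
product of the labels E (`prod_gradedPart`). Writing k = i' p^v, the pk parts equal to i have total
size p i i' p^v. This is symmetric in i and i', so they may be traded for p i p^v parts equal to i'.
That trade is θ, and it carries one labelling to the other.

For Δ the exponents of each [p]_j are compared through generating functions. Let P, R and C be the
series of all partitions, of class regular partitions and of p-cores, and let A_j and T_j be the
series of A_j(d) and of the total number of steps g_j. Then A_j(x) = P(x)^(p-1) x^j / (1 - x^j)
(`tsuchiokaSeries_mul_one_sub`), T_j(x) = R(x) x^(pj) / (1 - x^(pj))
(`mk_glaisherTotal_mul_one_sub`), P(x) = R(x) P(x^p) (`partitionSeries_eq_classRegularSeries_mul`),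
P(x) = C(x) P(x^p)^p (`partitionSeries_eq_coreSeries_mul`). The last two give C(x) P(x^p)^(p-1) =
R(x), hence C(x) A_j(x^p) = T_j(x), which is the equality of exponents. The last identity is the
decomposition into core and quotient, proved by encoding partitions as bead sets on p runners. -/

namespace GradedCartan

/-! ### Product formulas for partition series and the series of A_j(d) -/

section PowerSeriesIdentities

open PowerSeries hiding X
open Nat.Partition
open scoped PowerSeries.WithPiTopology

/-- The generating function of all partitions. -/
noncomputable def partitionSeries : ℚ⟦X⟧ :=
  PowerSeries.mk fun n => (Fintype.card n.Partition : ℚ)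

/-- The generating function of the `p`-class regular partitions. -/
noncomputable def classRegularSeries (p : ℕ) : ℚ⟦X⟧ :=
  PowerSeries.mk fun n => ((classRegular p n).card : ℚ)

/-- The generating function `∑ A_j(d) X ^ d`. -/
noncomputable def tsuchiokaSeries (p j : ℕ) : ℚ⟦X⟧ :=
  PowerSeries.mk fun d => tsuchiokaA p j d

/-- The geometric series `1 + X ^ i + X ^ (2 * i) + ...` for `i ≥ 1`. -/
noncomputable def geomSeries (i : ℕ) (hi : i ≠ 0) : ℚ⟦X⟧ :=
  PowerSeries.expand i hi (PowerSeries.mk 1)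

theorem geomSeries_mul_one_sub (i : ℕ) (hi : i ≠ 0) :
    geomSeries i hi * (1 - PowerSeries.X ^ i) = 1 := by
  have h := congrArg (PowerSeries.expand i hi) (PowerSeries.mk_one_mul_one_sub_eq_one ℚ)
  simpa [geomSeries] using h

theorem expand_geomSeries (p i : ℕ) (hp : p ≠ 0) (hi : i ≠ 0) :
    PowerSeries.expand p hp (geomSeries i hi) = geomSeries (p * i) (mul_ne_zero hp hi) :=
  (PowerSeries.expand_mul p hp i hi _).symm

theorem continuous_expand (p : ℕ) (hp : p ≠ 0) :
    Continuous (PowerSeries.expand p hp : ℚ⟦X⟧ → ℚ⟦X⟧) := by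
  rw [continuous_iff_continuousAt]
  intro f
  rw [ContinuousAt, PowerSeries.WithPiTopology.tendsto_iff_coeff_tendsto]
  intro d
  by_cases hd : p ∣ d
  · obtain ⟨m, rfl⟩ := hd
    simp only [PowerSeries.coeff_expand_mul]
    exact (PowerSeries.WithPiTopology.continuous_coeff ℚ m).continuousAt
  · simp only [PowerSeries.coeff_expand_of_not_dvd p hp _ hd]
    exact tendsto_const_nhds

/-- Since `expand` is continuous, it can be applied to the monomial expansion of f term by term.
This puts the factors of `hasProd_genFun` in closed form. -/
theorem one_add_tsum_coeff_smul (i : ℕ) (hi : i ≠ 0) (f : ℚ⟦X⟧)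
    (hf : PowerSeries.coeff 0 f = 1) :
    1 + ∑' j : ℕ, PowerSeries.coeff (j + 1) f • (PowerSeries.X : ℚ⟦X⟧) ^ (i * (j + 1))
      = PowerSeries.expand i hi f := by
  have h := (PowerSeries.hasSum_of_monomials_self f).map
    (PowerSeries.expand i hi) (continuous_expand i hi)
  have h2 : HasSum (fun j : ℕ => PowerSeries.coeff j f • (PowerSeries.X : ℚ⟦X⟧) ^ (i * j))
      (PowerSeries.expand i hi f) := by
    convert! h using 1
    ext1 j
    rw [Function.comp_apply, PowerSeries.expand_monomial, PowerSeries.X_pow_eq, ← map_smul,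
      smul_eq_mul, mul_one]
  have h3 := (hasSum_nat_add_iff' 1).2 h2
  rw [h3.tsum_eq]
  simp [hf]

theorem hasProd_expand_genFun (φ : ℕ → ℚ⟦X⟧) (hφ : ∀ i, PowerSeries.coeff 0 (φ i) = 1) :
    HasProd (fun i : ℕ => PowerSeries.expand (i + 1) i.succ_ne_zero (φ (i + 1)))
      (genFun fun i c => PowerSeries.coeff c (φ i)) := by
  convert! hasProd_genFun (fun i c => PowerSeries.coeff c (φ i)) using 1
  ext1 i
  exact (one_add_tsum_coeff_smul _ _ _ (hφ _)).symm

theorem hasProd_geomSeries :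
    HasProd (fun i : ℕ => geomSeries (i + 1) i.succ_ne_zero) partitionSeries := by
  convert! hasProd_expand_genFun (fun _ => PowerSeries.mk 1) (by simp) using 1
  ext n
  simp [partitionSeries, genFun, Finsupp.prod]

/-- By Glaisher's theorem R is also the product of the finite sums 1 + x^i + ... + x^(i(p-1));
multiplying each by 1 / (1 - x^(pi)) gives 1 / (1 - x^i). -/
theorem partitionSeries_eq_classRegularSeries_mul (p : ℕ) (hp : p ≠ 0) :
    partitionSeries = classRegularSeries p * PowerSeries.expand p hp partitionSeries := by
  have h1 := hasProd_powerSeriesMk_card_countRestricted ℚ (Nat.pos_of_ne_zero hp)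
  rw [← powerSeriesMk_card_restricted_eq_powerSeriesMk_card_countRestricted ℚ
    (Nat.pos_of_ne_zero hp)] at h1
  have h2 := hasProd_geomSeries.map (PowerSeries.expand p hp) (continuous_expand p hp)
  refine hasProd_geomSeries.unique ?_
  convert! h1.mul h2 using 1
  ext1 i
  rw [Function.comp_apply, expand_geomSeries]
  refine mul_right_cancel₀ (b := 1 - PowerSeries.X ^ (p * (i + 1)))
    (right_ne_zero_of_mul_eq_one (geomSeries_mul_one_sub _ (mul_ne_zero hp i.succ_ne_zero))) ?_
  rw [mul_assoc, geomSeries_mul_one_sub, mul_one]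
  have h3 := geom_sum_mul_neg ((PowerSeries.X : ℚ⟦X⟧) ^ (i + 1)) p
  simp only [← pow_mul] at h3
  rw [mul_comm p, ← h3, mul_comm _ (1 - PowerSeries.X ^ (i + 1)), ← mul_assoc,
    geomSeries_mul_one_sub, one_mul]

theorem hasProd_pow {f : ℕ → ℚ⟦X⟧} {a : ℚ⟦X⟧} (h : HasProd f a) (k : ℕ) :
    HasProd (fun i => f i ^ k) (a ^ k) := by
  induction k with
  | zero => simp
  | succ k ih => simpa only [pow_succ] using ih.mul h

theorem genFun_geomSeries_pow (k : ℕ) :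
    genFun (fun _ c => PowerSeries.coeff c ((PowerSeries.mk 1 : ℚ⟦X⟧) ^ k))
      = partitionSeries ^ k := by
  refine (hasProd_expand_genFun (fun _ => (PowerSeries.mk 1 : ℚ⟦X⟧) ^ k) ?_).unique ?_
  · simp
  · simpa only [map_pow, geomSeries] using hasProd_pow hasProd_geomSeries k

theorem genFun_geomSeries_pow_ite (k j : ℕ) (hj : j ≠ 0) :
    genFun (fun i c => PowerSeries.coeff c
      ((PowerSeries.mk 1 : ℚ⟦X⟧) ^ k * if i = j then PowerSeries.mk 1 else 1))
      = partitionSeries ^ k * geomSeries j hj := by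
  obtain ⟨j, rfl⟩ := Nat.exists_eq_succ_of_ne_zero hj
  refine (hasProd_expand_genFun (fun i => (PowerSeries.mk 1 : ℚ⟦X⟧) ^ k *
    if i = j + 1 then PowerSeries.mk 1 else 1) ?_).unique ?_
  · intro i
    split_ifs <;> simp
  · convert! (hasProd_pow hasProd_geomSeries k).mul
      (hasProd_ite_eq j (geomSeries (j + 1) j.succ_ne_zero)) using 1
    ext1 i
    rw [map_mul, map_pow]
    congr 1
    by_cases h : i = j
    · subst h
      simp [geomSeries]
    · simp [h]

/-- Every multiplicity weight normalised by `w i 0 = 1` may be taken over all indices. -/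
theorem toFinsupp_prod_eq {d : ℕ} (lam : d.Partition) (w : ℕ → ℕ → ℚ) (hw : ∀ i, w i 0 = 1) :
    lam.parts.toFinsupp.prod w = ∏ i ∈ Finset.Icc 1 d, w i (mult lam i) := by
  refine Finsupp.prod_of_support_subset _ ?_ _ fun i _ => hw i
  intro i hi
  rw [Multiset.toFinsupp_support, Multiset.mem_toFinset] at hi
  exact Finset.mem_Icc.2 ⟨lam.parts_pos hi, lam.le_of_mem_parts hi⟩

theorem coeff_mk_one_pow {k : ℕ} (hk : k ≠ 0) (m : ℕ) :
    PowerSeries.coeff m ((PowerSeries.mk 1 : ℚ⟦X⟧) ^ k) = ((k - 1 + m).choose m : ℚ) := by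
  obtain ⟨k, rfl⟩ := Nat.exists_eq_succ_of_ne_zero hk
  rw [Nat.succ_eq_add_one, PowerSeries.mk_one_pow_eq_mk_choose_add, PowerSeries.coeff_mk,
    Nat.add_sub_cancel, Nat.choose_symm_add]

/-- The factor 1 + m/(p-1) raises the exponent of the geometric series by one, from p - 1 to p; so
the weight m_j/(p-1) in A_j(d) amounts to an extra factor 1 / (1 - x^j), minus the unmodified term.
-/
theorem one_add_div_mul_choose {p : ℕ} (hp : 2 ≤ p) (m : ℕ) :
    (1 + (m : ℚ) / ((p : ℚ) - 1)) * ((p - 2 + m).choose m : ℚ) = ((p - 1 + m).choose m : ℚ) := by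
  obtain ⟨r, rfl⟩ := Nat.exists_eq_add_of_le' hp
  have h := Nat.add_one_mul_choose_eq (r + m) r
  have h1 : (r + 2 - 2 + m).choose m = (r + m).choose r := by
    rw [Nat.add_sub_cancel, Nat.choose_symm_add]
  have h2 : (r + 2 - 1 + m).choose m = (r + m + 1).choose (r + 1) := by
    rw [show r + 2 - 1 = r + 1 by omega, ← Nat.choose_symm_add]
    congr 1
    omega
  rw [h1, h2]
  have h3 := congrArg (Nat.cast (R := ℚ)) h
  push_cast at h3 ⊢
  have : (r : ℚ) + 2 - 1 ≠ 0 := by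
    have := Nat.cast_nonneg (α := ℚ) r
    linarith
  field_simp
  linear_combination h3

theorem tsuchiokaSeries_mul_one_sub {p : ℕ} (hp : 2 ≤ p) {j : ℕ} (hj : j ≠ 0) :
    tsuchiokaSeries p j * (1 - PowerSeries.X ^ j)
      = partitionSeries ^ (p - 1) * PowerSeries.X ^ j := by
  have key : tsuchiokaSeries p j
      = partitionSeries ^ (p - 1) * geomSeries j hj - partitionSeries ^ (p - 1) := by
    rw [← genFun_geomSeries_pow_ite, ← genFun_geomSeries_pow]
    ext d
    rw [map_sub, coeff_genFun, coeff_genFun, tsuchiokaSeries, PowerSeries.coeff_mk, tsuchiokaA,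
      ← Finset.sum_sub_distrib]
    refine Finset.sum_congr rfl fun lam _ => ?_
    rw [toFinsupp_prod_eq, toFinsupp_prod_eq]
    rotate_left
    · simp
    · intro i
      split_ifs <;> simp
    have h1 : ∀ m, PowerSeries.coeff m ((PowerSeries.mk 1 : ℚ⟦X⟧) ^ (p - 1))
        = ((p - 2 + m).choose m : ℚ) := fun m => by
      rw [coeff_mk_one_pow (by omega), show p - 1 - 1 = p - 2 by omega]
    have h2 : ∀ m, PowerSeries.coeff m ((PowerSeries.mk 1 : ℚ⟦X⟧) ^ (p - 1) * PowerSeries.mk 1)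
        = (1 + (m : ℚ) / ((p : ℚ) - 1)) * ((p - 2 + m).choose m : ℚ) := fun m => by
      rw [← pow_succ, show p - 1 + 1 = p by omega, coeff_mk_one_pow (by omega),
        one_add_div_mul_choose hp]
    have h3 : ∀ i, PowerSeries.coeff (mult lam i)
        ((PowerSeries.mk 1 : ℚ⟦X⟧) ^ (p - 1) * if i = j then PowerSeries.mk 1 else 1)
        = (if i = j then 1 + (mult lam j : ℚ) / ((p : ℚ) - 1) else 1) *
          ((p - 2 + mult lam i).choose (mult lam i) : ℚ) := fun i => by
      split_ifs with h
      · rw [h2, h]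
      · rw [mul_one, h1, one_mul]
    simp only [h1, h3]
    rw [Finset.prod_mul_distrib, Finset.prod_ite_eq']
    -- When j lies outside `Icc 1 d` the modified factor never appears, and m_j = 0 makes both sides
    -- vanish.
    split_ifs with h
    · ring
    · have : mult lam j = 0 := by
        refine Multiset.count_eq_zero.2 fun hm => h ?_
        exact Finset.mem_Icc.2 ⟨lam.parts_pos hm, lam.le_of_mem_parts hm⟩
      simp [this]
  rw [key, sub_mul, mul_assoc, geomSeries_mul_one_sub]
  ring

end PowerSeriesIdentities

/-! ### Counting Glaisher steps, and p-adic bookkeeping -/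

section Glaisher

/-- Conservation law for the part k: each g_k removes p copies, and each g_i with pi = k creates
one. -/
theorem GlaisherPath.count_add {p : ℕ} {s t : Multiset ℕ} {l : List ℕ} (h : GlaisherPath p s l t)
    (k : ℕ) : t.count k + p * l.count k = s.count k + (l.map (p * ·)).count k := by
  induction h with
  | nil s => simp
  | @cons s t l i hi h ih =>
    rw [count_glaisherStep] at ih
    rw [List.map_cons, List.count_cons, List.count_cons, mul_add]
    simp only [beq_iff_eq, eq_comm (a := k)] at ih ⊢
    by_cases h1 : i = k
    · subst h1
      simp only [if_true] at ih ⊢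
      omega
    · simp only [h1, if_false] at ih ⊢
      omega

theorem mem_classRegular {p n : ℕ} {lam : n.Partition} :
    lam ∈ classRegular p n ↔ ∀ i ∈ lam.parts, ¬ p ∣ i := by
  simp [classRegular, Nat.Partition.restricted]

/-- Carrying in base p: the copies of a p^(b+1) all come from steps g_(a p^b), and fewer than p of
any part remain at the end, so each step count is the previous one divided by p. -/
theorem glaisherCount_mul_pow {p : ℕ} (hp : 2 ≤ p) {s : Multiset ℕ} (hs : ∀ i ∈ s, ¬ p ∣ i)
    {a : ℕ} (ha : ¬ p ∣ a) (b : ℕ) :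
    glaisherCount p s (a * p ^ b) = s.count a / p ^ (b + 1) := by
  obtain ⟨l, hl⟩ := exists_isGlaisherSequence hp s
  rw [glaisherCount_eq hp hl]
  obtain ⟨t, hpath, ht⟩ := hl
  have hdiv : ∀ {x y z : ℕ}, x + p * y = z → x < p → y = z / p := fun {x y z} h hx => by
    rw [← h, Nat.add_mul_div_left _ _ (by omega), Nat.div_eq_of_lt hx, zero_add]
  induction b with
  | zero =>
    rw [pow_zero, mul_one, zero_add, pow_one]
    have h := hpath.count_add a
    rw [List.count_eq_zero (l := l.map (p * ·)) (a := a) |>.2, add_zero] at h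
    · exact hdiv h (ht a)
    · rintro hm
      obtain ⟨x, -, rfl⟩ := List.mem_map.1 hm
      exact ha (dvd_mul_right _ _)
  | succ b ih =>
    have h := hpath.count_add (a * p ^ (b + 1))
    rw [Multiset.count_eq_zero (s := s) |>.2 fun hm => hs _ hm
        (dvd_mul_of_dvd_right (dvd_pow_self p b.succ_ne_zero) a), zero_add,
      show a * p ^ (b + 1) = p * (a * p ^ b) by ring,
      List.count_map_of_injective l (p * ·) (mul_right_injective₀ (by omega : p ≠ 0)), ih] at h
    rw [show a * p ^ (b + 1) = p * (a * p ^ b) by ring, hdiv h (ht _), Nat.div_div_eq_div_mul,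
      pow_succ p (b + 1)]

theorem exists_eq_mul_pow {p : ℕ} (hp : 2 ≤ p) {k : ℕ} (hk : k ≠ 0) :
    ∃ a, ¬ p ∣ a ∧ k = a * p ^ multiplicity p k := by
  have hfin : FiniteMultiplicity p k := Nat.finiteMultiplicity_iff.2 ⟨by omega, by omega⟩
  obtain ⟨a, h, ha⟩ := hfin.exists_eq_pow_mul_and_not_dvd
  exact ⟨a, ha, by rw [mul_comm]; exact h⟩

theorem multiplicity_mul_pow {p : ℕ} (hp : 2 ≤ p) {a : ℕ} (ha : ¬ p ∣ a) (b : ℕ) :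
    multiplicity p (a * p ^ b) = b := by
  apply multiplicity_eq_of_dvd_of_not_dvd (Dvd.intro_left a rfl)
  rw [pow_succ, mul_comm a]
  exact fun h => ha (Nat.dvd_of_mul_dvd_mul_left (by positivity) h)

theorem mul_pow_inj {p : ℕ} (hp : 2 ≤ p) {a a' b b' : ℕ} (ha : ¬ p ∣ a) (ha' : ¬ p ∣ a')
    (h : a * p ^ b = a' * p ^ b') : a = a' ∧ b = b' := by
  have hb : b = b' := by
    rw [← multiplicity_mul_pow hp ha b, h, multiplicity_mul_pow hp ha']
  subst hb
  exact ⟨Nat.eq_of_mul_eq_mul_right (by positivity) h, rfl⟩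

theorem pow_dvd_iff_lt {p : ℕ} (hp : 2 ≤ p) {k : ℕ} (hk : k ≠ 0) (j : ℕ) :
    p ^ j ∣ k ↔ j ∈ Finset.range (multiplicity p k + 1) := by
  have hfin : FiniteMultiplicity p k := Nat.finiteMultiplicity_iff.2 ⟨by omega, by omega⟩
  rw [Finset.mem_range, Nat.lt_succ_iff, hfin.pow_dvd_iff_le_multiplicity]

theorem mult_mul_le {n : ℕ} (lam : n.Partition) (i : ℕ) : mult lam i * i ≤ n := by
  have h : Multiset.replicate (mult lam i) i ≤ lam.parts :=
    Multiset.le_count_iff_replicate_le.1 le_rfl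
  obtain ⟨u, hu⟩ := Multiset.le_iff_exists_add.1 h
  have := lam.parts_sum
  rw [hu, Multiset.sum_add, Multiset.sum_replicate, smul_eq_mul] at this
  omega

end Glaisher

/-! ### The two weights as products over boxes -/

section Boxes

/-- The indices of the boxes of the diagrams `D_i(lam)`: the label `i`, the row `k` and the
column `j`. -/
noncomputable def boxIndices (p : ℕ) {n : ℕ} (lam : n.Partition) : Finset (Σ _ : ℕ, Σ _ : ℕ, ℕ) :=
  ((Finset.Icc 1 n).filter fun i => ¬ p ∣ i).sigma fun i =>
    (Finset.Icc 1 (mult lam i / p)).sigma fun k => Finset.range (multiplicity p k + 1)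

theorem finprod_box {p : ℕ} (hp : 2 ≤ p) (n : ℕ) (f : ℕ → ℕ → ℕ → ℤ[X]) :
    ∏ᶠ c : Box p n, f c.i c.j c.k =
      ∏ lam ∈ classRegular p n, ∏ i ∈ (Finset.Icc 1 n).filter (fun i => ¬ p ∣ i),
        ∏ k ∈ Finset.Icc 1 (mult lam i / p), ∏ j ∈ Finset.range (multiplicity p k + 1),
          f i j k := by
  have := Box.finite hp n
  let := Fintype.ofFinite (Box p n)
  rw [finprod_eq_prod_of_fintype]
  have hr : ∀ lam : n.Partition, (∏ i ∈ (Finset.Icc 1 n).filter (fun i => ¬ p ∣ i),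
        ∏ k ∈ Finset.Icc 1 (mult lam i / p), ∏ j ∈ Finset.range (multiplicity p k + 1), f i j k)
      = ∏ x ∈ boxIndices p lam, f x.1 x.2.2 x.2.1 := fun lam => by
    rw [boxIndices, Finset.prod_sigma]
    refine Finset.prod_congr rfl fun i _ => ?_
    rw [Finset.prod_sigma]
  simp only [hr]
  rw [← Finset.prod_sigma (classRegular p n) (boxIndices p)
    fun x => f x.2.1 x.2.2.2 x.2.2.1]
  refine Finset.prod_bij (fun c _ => ⟨c.lam, c.i, c.k, c.j⟩) ?_ ?_ ?_ ?_
  · intro c _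
    have h0 := c.one_le
    have h1 : 1 ≤ mult c.lam c.i := h0.trans (c.le_div.trans (Nat.div_le_self _ _))
    have h2 := mult_mul_le c.lam c.i
    have h3 : c.i ≠ 0 := fun h => c.not_dvd (h ▸ dvd_zero p)
    simp only [boxIndices, Finset.mem_sigma, Finset.mem_filter, Finset.mem_Icc]
    exact ⟨c.lam_mem, ⟨⟨by omega, by nlinarith⟩, c.not_dvd⟩, ⟨h0, c.le_div⟩,
      (pow_dvd_iff_lt hp (by omega) _).1 c.pow_dvd⟩
  · intro c _ c' _ h
    obtain ⟨lam, i, j, k, _, _, _, _, _⟩ := c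
    obtain ⟨lam', i', j', k', _, _, _, _, _⟩ := c'
    simp only [Sigma.mk.injEq, heq_eq_eq] at h
    obtain ⟨rfl, rfl, rfl, rfl⟩ := h
    rfl
  · rintro ⟨lam, i, k, j⟩ hx
    simp only [boxIndices, Finset.mem_sigma, Finset.mem_filter, Finset.mem_Icc] at hx
    obtain ⟨h1, ⟨-, h2⟩, ⟨h3, h4⟩, h5⟩ := hx
    exact ⟨⟨lam, i, j, k, h1, h2, h3, h4, (pow_dvd_iff_lt hp (by omega) _).2 h5⟩,
      Finset.mem_univ _, rfl⟩
  · intro c _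
    rfl

theorem gradedPart_of_not_dvd {p k : ℕ} (h : ¬ p ∣ k) : gradedPart p k = 1 := by
  rw [gradedPart, multiplicity_eq_zero.2 h, Finset.prod_range_zero]

/-- With k = a p^v, the factors [p]_(a p^s) for s ≤ v are listed in reverse by s = v - j. -/
theorem gradedPart_mul {p : ℕ} (hp : 2 ≤ p) {k : ℕ} (hk : k ≠ 0) :
    gradedPart p (p * k) = ∏ j ∈ Finset.range (multiplicity p k + 1), qInt p (k / p ^ j) := by
  obtain ⟨a, ha, hka⟩ := exists_eq_mul_pow hp hk
  set v := multiplicity p k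
  rw [show p * k = a * p ^ (v + 1) by rw [hka]; ring, gradedPart_eq hp ha,
    ← Finset.prod_range_reflect]
  refine Finset.prod_congr rfl fun j hj => ?_
  have hj' : j ≤ v := Nat.lt_succ_iff.1 (Finset.mem_range.1 hj)
  congr 1
  rw [show v + 1 - 1 - j = v - j by omega]
  symm
  apply Nat.div_eq_of_eq_mul_left (by positivity)
  rw [mul_assoc, ← pow_add, Nat.sub_add_cancel hj', ← hka]

theorem prod_gradedPart {p : ℕ} (hp : 2 ≤ p) (m : ℕ) :
    ∏ t ∈ Finset.Icc 1 m, gradedPart p t = ∏ k ∈ Finset.Icc 1 (m / p),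
      ∏ j ∈ Finset.range (multiplicity p k + 1), qInt p (k / p ^ j) := by
  have h1 : ∏ t ∈ Finset.Icc 1 m, gradedPart p t
      = ∏ t ∈ (Finset.Icc 1 (m / p)).image (p * ·), gradedPart p t := by
    symm
    apply Finset.prod_subset
    · intro t ht
      obtain ⟨k, hk, rfl⟩ := Finset.mem_image.1 ht
      rw [Finset.mem_Icc] at hk ⊢
      exact ⟨by nlinarith, (Nat.mul_le_mul_left p hk.2).trans (Nat.mul_div_le m p)⟩
    · intro t ht ht'
      apply gradedPart_of_not_dvd
      rintro ⟨k, rfl⟩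
      refine ht' (Finset.mem_image.2 ⟨k, ?_, rfl⟩)
      rw [Finset.mem_Icc] at ht ⊢
      refine ⟨Nat.pos_of_ne_zero ?_, (Nat.le_div_iff_mul_le (by omega)).2 (by linarith)⟩
      rintro rfl
      omega
  rw [h1, Finset.prod_image fun _ _ _ _ h => Nat.eq_of_mul_eq_mul_left (by omega) h]
  refine Finset.prod_congr rfl fun k hk => gradedPart_mul hp ?_
  have := (Finset.mem_Icc.1 hk).1
  omega

theorem card_Icc_filter_dvd (q m : ℕ) :
    ((Finset.Icc 1 m).filter (q ∣ ·)).card = m / q := by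
  rw [← Nat.Ioc_filter_dvd_card_eq_div m q]
  congr 1

/-- Exchanging the products over k and j turns the inner one into a power whose exponent counts the
multiples of p^j up to ⌊m_i / p⌋, which is the step count. Each l ≥ 1 is uniquely i p^j with p ∤ i,
so the pairs (i, j) run through the indices of w_G. -/
theorem wG_eq {p n : ℕ} (hp : 2 ≤ p) {lam : n.Partition} (hlam : lam ∈ classRegular p n) :
    wG p lam = ∏ i ∈ (Finset.Icc 1 n).filter (fun i => ¬ p ∣ i),
        ∏ k ∈ Finset.Icc 1 (mult lam i / p), ∏ j ∈ Finset.range (multiplicity p k + 1),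
          qInt p (i * p ^ j) := by
  have hreg := mem_classRegular.1 hlam
  have h1 : ∀ i ∈ (Finset.Icc 1 n).filter (fun i => ¬ p ∣ i),
      (∏ k ∈ Finset.Icc 1 (mult lam i / p), ∏ j ∈ Finset.range (multiplicity p k + 1),
          qInt p (i * p ^ j))
      = ∏ j ∈ Finset.range (n + 1), qInt p (i * p ^ j) ^ glaisherCount p lam.parts (i * p ^ j) := by
    intro i hi
    rw [Finset.mem_filter, Finset.mem_Icc] at hi
    have h2 : ∀ k ∈ Finset.Icc 1 (mult lam i / p), ∀ j,
        (k ∈ Finset.Icc 1 (mult lam i / p) ∧ j ∈ Finset.range (multiplicity p k + 1)) ↔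
        (k ∈ (Finset.Icc 1 (mult lam i / p)).filter (p ^ j ∣ ·) ∧ j ∈ Finset.range (n + 1)) := by
      intro k hk j
      rw [Finset.mem_Icc] at hk
      rw [← pow_dvd_iff_lt hp (by omega), Finset.mem_filter, Finset.mem_Icc]
      refine ⟨fun h => ⟨h, ?_⟩, fun h => h.1⟩
      have h3 := Nat.le_of_dvd (by omega) h.2
      have h4 : j < p ^ j := Nat.lt_pow_self (by omega)
      have h5 := mult_mul_le lam i
      have h6 : mult lam i / p ≤ mult lam i := Nat.div_le_self _ _
      rw [Finset.mem_range]
      nlinarith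
    rw [Finset.prod_comm' (t' := Finset.range (n + 1))
      (s' := fun j => (Finset.Icc 1 (mult lam i / p)).filter (p ^ j ∣ ·))]
    · refine Finset.prod_congr rfl fun j _ => ?_
      rw [Finset.prod_const, card_Icc_filter_dvd,
        glaisherCount_mul_pow hp hreg hi.2, Nat.div_div_eq_div_mul, pow_succ', mult]
    · intro k j
      by_cases hk : k ∈ Finset.Icc 1 (mult lam i / p)
      · exact h2 k hk j
      · simp only [hk, false_and, Finset.mem_filter]
  rw [Finset.prod_congr rfl h1, wG, ← Finset.prod_product', ← Finset.prod_image
    (g := fun x : ℕ × ℕ => x.1 * p ^ x.2)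
    (f := fun l => qInt p l ^ glaisherCount p lam.parts l)]
  · apply Finset.prod_subset
    · intro l hl
      rw [Finset.mem_Icc] at hl
      obtain ⟨a, ha, hla⟩ := exists_eq_mul_pow hp (by omega : l ≠ 0)
      have h0 : a ≠ 0 := fun h => ha (h ▸ dvd_zero p)
      have h3 : multiplicity p l < p ^ multiplicity p l := Nat.lt_pow_self (by omega)
      refine Finset.mem_image.2 ⟨(a, multiplicity p l), ?_, hla.symm⟩
      rw [Finset.mem_product, Finset.mem_filter, Finset.mem_Icc, Finset.mem_range]
      generalize hv : multiplicity p l = v at *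
      exact ⟨⟨⟨by omega, by nlinarith [Nat.one_le_two_pow (n := v)]⟩, ha⟩, by nlinarith [Nat.pos_of_ne_zero h0]⟩
    -- The rectangle of pairs also contains labels a p^b > n; a nonzero step count there would force
    -- p^(b+1) parts equal to a, which do not fit into n.
    · intro l hl hl'
      obtain ⟨⟨a, b⟩, hab, rfl⟩ := Finset.mem_image.1 hl
      rw [Finset.mem_product, Finset.mem_filter, Finset.mem_Icc] at hab
      rw [Finset.mem_Icc] at hl'
      dsimp only at *
      rw [glaisherCount_mul_pow hp hreg hab.1.2, Nat.div_eq_of_lt, pow_zero]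
      by_contra hcon
      have h5 := mult_mul_le lam a
      rw [mult] at h5
      have h6 : p ^ b ≤ p ^ (b + 1) := Nat.pow_le_pow_right (by omega) (by omega)
      have h7 : 0 < p ^ b := by positivity
      refine hl' ⟨by nlinarith, ?_⟩
      calc a * p ^ b ≤ a * lam.parts.count a := Nat.mul_le_mul_left _ (by omega)
        _ ≤ n := by linarith
  · rintro ⟨a, b⟩ h ⟨a', b'⟩ h' heq
    simp only [Finset.coe_product, Set.mem_prod, Finset.mem_coe, Finset.mem_filter] at h h'
    obtain ⟨rfl, rfl⟩ := mul_pow_inj hp h.1.2 h'.1.2 heq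
    rfl

theorem prod_wG_eq_finprod {p : ℕ} (hp : 2 ≤ p) (n : ℕ) :
    ∏ lam ∈ classRegular p n, wG p lam = ∏ᶠ c : Box p n, qInt p c.G := by
  refine Eq.trans ?_ (finprod_box hp n fun i j _ => qInt p (i * p ^ j)).symm
  exact Finset.prod_congr rfl fun lam hlam => wG_eq hp hlam

theorem prod_wE_eq_finprod {p : ℕ} (hp : 2 ≤ p) (n : ℕ) :
    ∏ lam ∈ classRegular p n, wE p lam = ∏ᶠ c : Box p n, qInt p c.E := by
  refine Eq.trans ?_ (finprod_box hp n fun _ j k => qInt p (k / p ^ j)).symm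
  exact Finset.prod_congr rfl fun lam _ =>
    Finset.prod_congr rfl fun i _ => prod_gradedPart hp _

end Boxes

/-! ### The involution on boxes -/

section Involution

/-- The label `i'` of `θ(lam; i, j, k)`, the part of `k` prime to powers of `p`. -/
noncomputable def Box.coLabel {p n : ℕ} (c : Box p n) : ℕ := c.k / p ^ multiplicity p c.k

theorem Box.k_eq {p n : ℕ} (hp : 2 ≤ p) (c : Box p n) :
    ¬ p ∣ c.coLabel ∧ c.k = c.coLabel * p ^ multiplicity p c.k := by
  obtain ⟨a, ha, h⟩ := exists_eq_mul_pow hp (k := c.k) (by have := c.one_le; omega)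
  have h2 : c.coLabel = a := by
    rw [Box.coLabel]
    exact Nat.div_eq_of_eq_mul_left (by positivity) h
  rw [h2]
  exact ⟨ha, h⟩

theorem Box.j_le {p n : ℕ} (hp : 2 ≤ p) (c : Box p n) : c.j ≤ multiplicity p c.k := by
  have := (pow_dvd_iff_lt hp (by have := c.one_le; omega) c.j).1 c.pow_dvd
  rw [Finset.mem_range] at this
  omega

theorem Box.replicate_le {p n : ℕ} (c : Box p n) :
    Multiset.replicate (p * c.k) c.i ≤ c.lam.parts := by
  refine Multiset.le_count_iff_replicate_le.1 ?_
  exact (Nat.mul_le_mul_left p c.le_div).trans (Nat.mul_div_le _ p)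

/-- The parts of `θ(c)`. -/
noncomputable def Box.coParts {p n : ℕ} (c : Box p n) : Multiset ℕ :=
  (c.lam.parts - Multiset.replicate (p * c.k) c.i)
    + Multiset.replicate (p * (c.i * p ^ multiplicity p c.k)) c.coLabel

/-- The removed and the added parts both have total size p i i' p^v, where v is the multiplicity of
p in k. -/
theorem Box.sum_coParts {p n : ℕ} (hp : 2 ≤ p) (c : Box p n) : c.coParts.sum = n := by
  have h := congrArg Multiset.sum (tsub_add_cancel_of_le c.replicate_le)
  have hk := (c.k_eq hp).2
  rw [Multiset.sum_add, c.lam.parts_sum, Multiset.sum_replicate, smul_eq_mul] at h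
  rw [Box.coParts, Multiset.sum_add, Multiset.sum_replicate, smul_eq_mul]
  refine Eq.trans ?_ h
  congr 1
  calc p * (c.i * p ^ multiplicity p c.k) * c.coLabel
      = p * (c.coLabel * p ^ multiplicity p c.k) * c.i := by ring
    _ = p * c.k * c.i := by rw [← hk]

theorem Box.not_dvd_of_mem_coParts {p n : ℕ} (hp : 2 ≤ p) (c : Box p n) {x : ℕ}
    (hx : x ∈ c.coParts) : ¬ p ∣ x := by
  rcases Multiset.mem_add.1 hx with hx | hx
  · exact mem_classRegular.1 c.lam_mem x (Multiset.mem_of_le (Multiset.sub_le_self _ _) hx)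
  · rw [Multiset.eq_of_mem_replicate hx]
    exact (c.k_eq hp).1

/-- The involution `θ`. -/
noncomputable def Box.theta {p n : ℕ} (hp : 2 ≤ p) (c : Box p n) : Box p n where
  lam :=
    { parts := c.coParts
      parts_pos := fun {x} hx => Nat.pos_of_ne_zero fun h =>
        c.not_dvd_of_mem_coParts hp hx (h ▸ dvd_zero p)
      parts_sum := c.sum_coParts hp }
  i := c.coLabel
  j := multiplicity p c.k - c.j
  k := c.i * p ^ multiplicity p c.k
  lam_mem := mem_classRegular.2 fun _ hx => c.not_dvd_of_mem_coParts hp hx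
  not_dvd := (c.k_eq hp).1
  one_le := Nat.one_le_iff_ne_zero.2
    (mul_ne_zero (fun h => c.not_dvd (h ▸ dvd_zero p)) (by positivity))
  le_div := by
    rw [Nat.le_div_iff_mul_le (by omega)]
    change _ ≤ Multiset.count c.coLabel (_ + Multiset.replicate _ _)
    rw [Multiset.count_add, Multiset.count_replicate_self, mul_comm]
    exact Nat.le_add_left _ _
  pow_dvd := dvd_mul_of_dvd_right (pow_dvd_pow p (Nat.sub_le _ _)) _

theorem Box.multiplicity_theta {p n : ℕ} (hp : 2 ≤ p) (c : Box p n) :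
    multiplicity p (c.theta hp).k = multiplicity p c.k :=
  multiplicity_mul_pow hp c.not_dvd _

theorem Box.coLabel_theta {p n : ℕ} (hp : 2 ≤ p) (c : Box p n) :
    (c.theta hp).coLabel = c.i := by
  rw [Box.coLabel, c.multiplicity_theta hp]
  exact Nat.mul_div_cancel _ (by positivity)

theorem Box.ext {p n : ℕ} {c c' : Box p n} (h1 : c.lam.parts = c'.lam.parts) (h2 : c.i = c'.i)
    (h3 : c.j = c'.j) (h4 : c.k = c'.k) : c = c' := by
  obtain ⟨lam, i, j, k, _, _, _, _, _⟩ := c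
  obtain ⟨lam', i', j', k', _, _, _, _, _⟩ := c'
  obtain rfl : lam = lam' := Nat.Partition.ext h1
  dsimp only at h2 h3 h4
  subst h2 h3 h4
  rfl

/-- The exponent v = j + j' is preserved because p ∤ i, so the second application removes exactly
the parts that the first one added. -/
theorem Box.theta_involutive {p n : ℕ} (hp : 2 ≤ p) :
    Function.Involutive (Box.theta hp : Box p n → Box p n) := by
  intro c
  have hk := (c.k_eq hp).2
  refine Box.ext ?_ (c.coLabel_theta hp) ?_ ?_
  · change (c.theta hp).coParts = _
    rw [Box.coParts, c.multiplicity_theta hp, c.coLabel_theta hp]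
    change c.coParts - Multiset.replicate (p * (c.i * p ^ multiplicity p c.k)) c.coLabel +
      Multiset.replicate (p * (c.coLabel * p ^ multiplicity p c.k)) c.i = _
    rw [Box.coParts, add_tsub_cancel_right, ← hk, tsub_add_cancel_of_le c.replicate_le]
  · change multiplicity p (c.theta hp).k - (multiplicity p c.k - c.j) = c.j
    have := c.j_le hp
    rw [c.multiplicity_theta hp]
    omega
  · change c.coLabel * p ^ multiplicity p (c.theta hp).k = c.k
    rw [c.multiplicity_theta hp, ← hk]

theorem Box.E_theta {p n : ℕ} (hp : 2 ≤ p) (c : Box p n) : (c.theta hp).E = c.G := by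
  change c.i * p ^ multiplicity p c.k / p ^ (multiplicity p c.k - c.j) = c.i * p ^ c.j
  apply Nat.div_eq_of_eq_mul_left (by positivity)
  rw [mul_assoc, ← pow_add, Nat.add_sub_cancel' (c.j_le hp)]

theorem Box.theta_spec {p n : ℕ} (hp : 2 ≤ p) (c : Box p n) :
    c.k = (c.theta hp).i * p ^ (c.j + (c.theta hp).j) ∧
    (c.theta hp).k = c.i * p ^ (c.j + (c.theta hp).j) ∧
    ∃ μ : Multiset ℕ,
      c.lam.parts = μ + Multiset.replicate (p * c.k) c.i ∧
      (c.theta hp).lam.parts = μ + Multiset.replicate (p * (c.theta hp).k) (c.theta hp).i := by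
  have hj : c.j + (c.theta hp).j = multiplicity p c.k := Nat.add_sub_cancel' (c.j_le hp)
  rw [hj]
  exact ⟨(c.k_eq hp).2, rfl, _, (tsub_add_cancel_of_le c.replicate_le).symm, rfl⟩

theorem finprod_G_eq_finprod_E {p : ℕ} (hp : 2 ≤ p) (n : ℕ) :
    ∏ᶠ c : Box p n, qInt p c.G = ∏ᶠ c : Box p n, qInt p c.E :=
  finprod_eq_of_bijective (Box.theta hp) (Box.theta_involutive hp).bijective
    fun c => by rw [Box.E_theta]

end Involution

/-! ### The series of total Glaisher step counts -/

section GlaisherSeries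

/-- The total number of steps `g_l` over the `p`-class regular partitions of `n`. -/
noncomputable def glaisherTotal (p l n : ℕ) : ℕ :=
  ∑ lam ∈ classRegular p n, glaisherCount p lam.parts l

/-- Adding q parts equal to a is a bijection onto the partitions with m_a ≥ q and raises the
quotient by one; partitions with m_a < q contribute zero. -/
theorem sum_mult_div {p : ℕ} {a q : ℕ} (ha : ¬ p ∣ a) (hq : 0 < q) (n : ℕ) :
    ∑ lam ∈ classRegular p (n + q * a), mult lam a / q
      = (∑ lam ∈ classRegular p n, mult lam a / q) + (classRegular p n).card := by
  have ha0 : 0 < a := Nat.pos_of_ne_zero fun h => ha (h ▸ dvd_zero p)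
  rw [Finset.card_eq_sum_ones, ← Finset.sum_add_distrib]
  rw [← Finset.sum_filter_of_ne (p := fun lam => q ≤ mult lam a)]
  swap
  · intro lam _ h
    by_contra hlt
    exact h (Nat.div_eq_of_lt (by omega))
  symm
  refine Finset.sum_bij (fun lam _ => ⟨lam.parts + Multiset.replicate q a, ?_, ?_⟩) ?_ ?_ ?_ ?_
  · intro i hi
    rcases Multiset.mem_add.1 hi with hi | hi
    · exact lam.parts_pos hi
    · rw [Multiset.eq_of_mem_replicate hi]
      exact ha0
  · rw [Multiset.sum_add, lam.parts_sum, Multiset.sum_replicate, smul_eq_mul]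
  · intro lam hlam
    rw [Finset.mem_filter, mem_classRegular]
    refine ⟨fun i hi => ?_, ?_⟩
    · rcases Multiset.mem_add.1 hi with hi | hi
      · exact mem_classRegular.1 hlam i hi
      · rwa [Multiset.eq_of_mem_replicate hi]
    · simp [mult]
  · intro lam _ lam' _ h
    exact Nat.Partition.ext (add_right_cancel (congrArg Nat.Partition.parts h))
  · intro lam hlam
    rw [Finset.mem_filter, mem_classRegular] at hlam
    have hle : Multiset.replicate q a ≤ lam.parts := Multiset.le_count_iff_replicate_le.1 hlam.2
    have hsum := congrArg Multiset.sum (tsub_add_cancel_of_le hle)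
    rw [Multiset.sum_add, lam.parts_sum, Multiset.sum_replicate, smul_eq_mul] at hsum
    refine ⟨⟨lam.parts - Multiset.replicate q a, fun {i} hi => lam.parts_pos
      (Multiset.mem_of_le (Multiset.sub_le_self _ _) hi), by omega⟩, ?_, ?_⟩
    · exact mem_classRegular.2 fun i hi => hlam.1 i
        (Multiset.mem_of_le (Multiset.sub_le_self _ _) hi)
    · exact Nat.Partition.ext (tsub_add_cancel_of_le hle)
  · intro lam _
    simp [mult, Nat.add_div_right _ hq]

theorem glaisherTotal_add {p : ℕ} (hp : 2 ≤ p) {l : ℕ} (hl : l ≠ 0) (n : ℕ) :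
    glaisherTotal p l (n + p * l) = glaisherTotal p l n + (classRegular p n).card := by
  obtain ⟨a, ha, h⟩ := exists_eq_mul_pow hp hl
  generalize multiplicity p l = b at h
  subst h
  have key : ∀ m, glaisherTotal p (a * p ^ b) m
      = ∑ lam ∈ classRegular p m, mult lam a / p ^ (b + 1) := fun m =>
    Finset.sum_congr rfl fun lam hlam =>
      glaisherCount_mul_pow hp (mem_classRegular.1 hlam) ha b
  rw [key, key, ← sum_mult_div ha (by positivity), show p * (a * p ^ b) = p ^ (b + 1) * a by ring]

theorem glaisherCount_eq_zero {p n : ℕ} (hp : 2 ≤ p) {l : ℕ} (hl : l ≠ 0) (hn : n < p * l)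
    {lam : n.Partition} (hlam : lam ∈ classRegular p n) : glaisherCount p lam.parts l = 0 := by
  obtain ⟨a, ha, h⟩ := exists_eq_mul_pow hp hl
  generalize multiplicity p l = b at h
  subst h
  rw [glaisherCount_mul_pow hp (mem_classRegular.1 hlam) ha]
  apply Nat.div_eq_of_lt
  have h5 := mult_mul_le lam a
  rw [mult] at h5
  by_contra hcon
  have : p * (a * p ^ b) ≤ n := calc
    p * (a * p ^ b) = p ^ (b + 1) * a := by ring
    _ ≤ lam.parts.count a * a := Nat.mul_le_mul_right _ (by omega)
    _ ≤ n := h5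
  omega

theorem glaisherTotal_eq_zero {p n : ℕ} (hp : 2 ≤ p) {l : ℕ} (hl : l ≠ 0) (hn : n < p * l) :
    glaisherTotal p l n = 0 :=
  Finset.sum_eq_zero fun _ hlam => glaisherCount_eq_zero hp hl hn hlam

theorem mk_glaisherTotal_mul_one_sub {p : ℕ} (hp : 2 ≤ p) {l : ℕ} (hl : l ≠ 0) :
    (PowerSeries.mk fun n => (glaisherTotal p l n : ℚ)) * (1 - PowerSeries.X ^ (p * l))
      = classRegularSeries p * PowerSeries.X ^ (p * l) := by
  ext n
  rw [mul_sub, mul_one, map_sub, PowerSeries.coeff_mul_X_pow', PowerSeries.coeff_mul_X_pow',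
    PowerSeries.coeff_mk]
  split_ifs with h
  · obtain ⟨m, rfl⟩ := Nat.exists_eq_add_of_le' h
    rw [Nat.add_sub_cancel, PowerSeries.coeff_mk, classRegularSeries, PowerSeries.coeff_mk,
      glaisherTotal_add hp hl]
    push_cast
    ring
  · rw [glaisherTotal_eq_zero hp hl (by omega)]
    simp

end GlaisherSeries

/-! ### Finite bead sets and their energy -/

section Beads

theorem sum_range_card_le (S : Finset ℕ) : ∑ x ∈ Finset.range S.card, x ≤ ∑ x ∈ S, x := by
  induction S using Finset.induction_on_max with
  | empty => simp
  | insert a s ha ih =>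
    have hna : a ∉ s := fun h => lt_irrefl _ (ha a h)
    have hcard : s.card ≤ a := by
      simpa using Finset.card_le_card fun x hx => Finset.mem_range.2 (ha x hx)
    rw [Finset.card_insert_of_notMem hna, Finset.sum_range_succ, Finset.sum_insert hna]
    omega

/-- The sets of `N` beads of energy `m`. -/
def beads (N m : ℕ) : Finset (Finset ℕ) :=
  (Finset.powersetCard N (Finset.range (N + m))).filter fun S =>
    ∑ x ∈ S, x = m + ∑ x ∈ Finset.range N, x

/-- The bound N + m in the definition only ensures finiteness: the beads other than x have at least
the packed sum, so x ≤ N - 1 + m. -/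
theorem mem_beads {N m : ℕ} {S : Finset ℕ} :
    S ∈ beads N m ↔ S.card = N ∧ ∑ x ∈ S, x = m + ∑ x ∈ Finset.range N, x := by
  rw [beads, Finset.mem_filter, Finset.mem_powersetCard]
  refine ⟨fun h => ⟨h.1.2, h.2⟩, fun h => ⟨⟨fun x hx => ?_, h.1⟩, h.2⟩⟩
  have h1 := sum_range_card_le (S.erase x)
  have h2 := Finset.add_sum_erase S (fun x => x) hx
  have h3 := Finset.card_erase_add_one hx
  have h4 := h.2
  rw [← h.1, ← h3, Finset.sum_range_succ] at h4
  rw [Finset.mem_range, ← h.1, ← h3]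
  omega

/-- Filling a gap y yields N + 1 beads, whose sum is at least 0 + ... + N; this forces y + m ≥ N. -/
theorem mem_of_mem_beads {N m y : ℕ} {S : Finset ℕ} (hS : S ∈ beads N m) (hy : y + m < N) :
    y ∈ S := by
  by_contra hyS
  rw [mem_beads] at hS
  have h1 := sum_range_card_le (insert y S)
  rw [Finset.card_insert_of_notMem hyS, Finset.sum_insert hyS, Finset.sum_range_succ, hS.1,
    hS.2] at h1
  omega

end Beads

/-! ### Beta numbers of Young diagrams, and hooks -/

section BetaSets

/-- The first `N` beta numbers of a Young diagram. -/
def betaSet (Y : YoungDiagram) (N : ℕ) : Finset ℕ :=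
  (Finset.range N).image fun i => Y.rowLen (N - 1 - i) + i

theorem strictMono_beta (Y : YoungDiagram) (N : ℕ) :
    StrictMono fun i : Fin N => Y.rowLen (N - 1 - i) + (i : ℕ) := by
  intro a b hab
  have hab' : (a : ℕ) < b := hab
  have := Y.rowLen_anti (N - 1 - b) (N - 1 - a) (by omega)
  dsimp only
  omega

theorem injOn_beta (Y : YoungDiagram) (N : ℕ) :
    Set.InjOn (fun i => Y.rowLen (N - 1 - i) + i) (Finset.range N : Set ℕ) := by
  intro a ha b hb h
  rw [Finset.mem_coe, Finset.mem_range] at ha hb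
  have := (strictMono_beta Y N).injective (a₁ := ⟨a, ha⟩) (a₂ := ⟨b, hb⟩) h
  exact congrArg Fin.val this

theorem mem_betaSet {Y : YoungDiagram} {N b : ℕ} :
    b ∈ betaSet Y N ↔ ∃ i < N, b = Y.rowLen i + (N - 1 - i) := by
  simp only [betaSet, Finset.mem_image, Finset.mem_range]
  constructor
  · rintro ⟨i, hi, rfl⟩
    exact ⟨N - 1 - i, by omega, by congr 1; omega⟩
  · rintro ⟨i, hi, rfl⟩
    exact ⟨N - 1 - i, by omega, by congr 2; omega⟩

theorem rowLen_eq_zero {Y : YoungDiagram} {i : ℕ} (h : Y.colLen 0 ≤ i) : Y.rowLen i = 0 := by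
  by_contra hne
  have h1 : (i, 0) ∈ Y := YoungDiagram.mem_iff_lt_rowLen.2 (Nat.pos_of_ne_zero hne)
  have h2 := YoungDiagram.mem_iff_lt_colLen.1 h1
  omega

theorem sum_rowLens {Y : YoungDiagram} {N : ℕ} (hN : Y.colLen 0 ≤ N) :
    Y.rowLens.sum = ∑ i ∈ Finset.range N, Y.rowLen i := by
  rw [YoungDiagram.rowLens, ← Multiset.sum_coe, ← Multiset.map_coe]
  change ∑ i ∈ Finset.range (Y.colLen 0), Y.rowLen i = _
  apply Finset.sum_subset
  · exact Finset.range_subset_range.2 hN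
  · intro i _ hi
    exact rowLen_eq_zero (by simpa using hi)

theorem card_betaSet (Y : YoungDiagram) (N : ℕ) : (betaSet Y N).card = N := by
  rw [betaSet, Finset.card_image_of_injOn (injOn_beta Y N), Finset.card_range]

theorem betaSet_mem_beads {Y : YoungDiagram} {N : ℕ} (hN : Y.colLen 0 ≤ N) :
    betaSet Y N ∈ beads N Y.rowLens.sum := by
  rw [mem_beads]
  refine ⟨card_betaSet Y N, ?_⟩
  rw [betaSet, Finset.sum_image (injOn_beta Y N), Finset.sum_add_distrib, sum_rowLens hN,
    Finset.sum_range_reflect]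

/-- A finite set has only one increasing enumeration, and the beta numbers read from the bottom row
upwards are one. -/
theorem rowLen_eq_of_betaSet_eq {Y Z : YoungDiagram} {N : ℕ} (h : betaSet Y N = betaSet Z N)
    {i : ℕ} (hi : i < N) : Y.rowLen i = Z.rowLen i := by
  have h1 := Finset.orderEmbOfFin_unique (card_betaSet Y N)
    (f := fun i : Fin N => Y.rowLen (N - 1 - i) + (i : ℕ))
    (fun x => Finset.mem_image.2 ⟨x, Finset.mem_range.2 x.2, rfl⟩) (strictMono_beta Y N)
  have h2 := Finset.orderEmbOfFin_unique (card_betaSet Y N)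
    (f := fun i : Fin N => Z.rowLen (N - 1 - i) + (i : ℕ))
    (fun x => h ▸ Finset.mem_image.2 ⟨x, Finset.mem_range.2 x.2, rfl⟩) (strictMono_beta Z N)
  have h3 := congrFun (h1.trans h2.symm) ⟨N - 1 - i, by omega⟩
  dsimp only at h3
  rw [show N - 1 - (N - 1 - i) = i by omega] at h3
  omega

theorem eq_of_betaSet_eq {Y Z : YoungDiagram} {N : ℕ} (hY : Y.colLen 0 ≤ N)
    (hZ : Z.colLen 0 ≤ N) (h : betaSet Y N = betaSet Z N) : Y = Z := by
  ext ⟨i, j⟩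
  rw [YoungDiagram.mem_cells, YoungDiagram.mem_cells, YoungDiagram.mem_iff_lt_rowLen,
    YoungDiagram.mem_iff_lt_rowLen]
  rcases lt_or_ge i N with hi | hi
  · rw [rowLen_eq_of_betaSet_eq h hi]
  · rw [rowLen_eq_zero (hY.trans hi), rowLen_eq_zero (hZ.trans hi)]

/-- If e enumerates S increasingly, the differences e(a) - a are nonnegative and weakly increasing,
hence row lengths once reversed. -/
theorem exists_betaSet_eq (S : Finset ℕ) :
    ∃ Y : YoungDiagram, Y.colLen 0 ≤ S.card ∧ betaSet Y S.card = S := by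
  set N := S.card with hN
  set e := S.orderEmbOfFin hN.symm
  have hmono : ∀ a b : Fin N, a ≤ b → (b : ℕ) + e a ≤ e b + a := by
    intro a b hab
    obtain ⟨a, ha⟩ := a
    obtain ⟨b, hb⟩ := b
    obtain ⟨d, rfl⟩ := Nat.exists_eq_add_of_le (Fin.mk_le_mk.1 hab)
    induction d with
    | zero => simp; omega
    | succ d ih =>
      have h1 := ih (by omega) (Fin.mk_le_mk.2 (by omega))
      have h2 : e ⟨a + d, by omega⟩ < e ⟨a + (d + 1), hb⟩ :=
        e.strictMono (Fin.mk_lt_mk.2 (by omega))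
      dsimp only at h1 ⊢
      omega
  have hle : ∀ a : Fin N, (a : ℕ) ≤ e a := by
    intro a
    have h1 := hmono ⟨0, by have := a.2; omega⟩ a (Fin.mk_le_mk.2 (Nat.zero_le _))
    dsimp only at h1
    omega
  set w : List ℕ := List.ofFn fun i : Fin N => e i.rev - (i.rev : ℕ) with hw
  have hsort : w.SortedGE := by
    rw [hw, List.sortedGE_ofFn_iff]
    intro a b hab
    have := hmono b.rev a.rev (Fin.rev_le_rev.2 hab)
    have := hle b.rev
    dsimp only
    omega
  have hlen : w.length = N := by rw [hw, List.length_ofFn]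
  have hrow : ∀ i : Fin N, (YoungDiagram.ofRowLens w hsort).rowLen i = e i.rev - (i.rev : ℕ) := by
    intro i
    have := YoungDiagram.rowLen_ofRowLens (w := w) (hw := hsort) ⟨i, by rw [hlen]; exact i.2⟩
    rw [this]
    simp [hw]
  refine ⟨YoungDiagram.ofRowLens w hsort, ?_, ?_⟩
  · by_contra hcon
    have h1 := YoungDiagram.mem_iff_lt_colLen.2 (not_le.1 hcon)
    rw [YoungDiagram.mem_ofRowLens] at h1
    obtain ⟨h2, -⟩ := h1
    dsimp only at h2
    omega
  · refine Finset.eq_of_subset_of_card_le ?_ (by rw [card_betaSet])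
    intro b hb
    obtain ⟨i, hi, rfl⟩ := mem_betaSet.1 hb
    have h1 := hrow ⟨i, hi⟩
    have h2 := hle (Fin.rev ⟨i, hi⟩)
    have h3 : ((Fin.rev ⟨i, hi⟩ : Fin N) : ℕ) = N - 1 - i := by rw [Fin.val_rev]; dsimp only; omega
    dsimp only at h1
    rw [h1]
    rw [h3] at h2 ⊢
    rw [Nat.sub_add_cancel h2]
    exact Finset.orderEmbOfFin_mem _ _ _

/-- Removing a hook of length `p` corresponds to moving a bead `p` places down. -/
theorem exists_hookLength_eq_iff {Y : YoungDiagram} {N p : ℕ} (hN : Y.colLen 0 ≤ N) (hp : 0 < p) :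
    (∃ c ∈ Y, hookLength Y c = p) ↔ ∃ b ∈ betaSet Y N, p ≤ b ∧ b - p ∉ betaSet Y N := by
  have hcol : ∀ j, Y.colLen j ≤ N := fun j => (Y.colLen_anti 0 j (Nat.zero_le _)).trans hN
  have hiff : ∀ i j, j < Y.rowLen i ↔ i < Y.colLen j := fun i j => by
    rw [← YoungDiagram.mem_iff_lt_rowLen, YoungDiagram.mem_iff_lt_colLen]
  constructor
  · rintro ⟨⟨i, j⟩, hc, h⟩
    have h1 : j < Y.rowLen i := YoungDiagram.mem_iff_lt_rowLen.1 hc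
    have h2 := (hiff i j).1 h1
    have h3 := hcol j
    rw [hookLength] at h
    dsimp only at h
    -- The bead moves to j + N - `Y.colLen j`. Rows meeting column j have beads strictly above this
    -- position, all others strictly below, so it is a gap.
    refine ⟨Y.rowLen i + (N - 1 - i), mem_betaSet.2 ⟨i, by omega, rfl⟩, by omega, ?_⟩
    rw [mem_betaSet]
    rintro ⟨i', hi', h4⟩
    have h5 := hiff i' j
    rcases lt_or_ge j (Y.rowLen i') with h6 | h6
    · have := h5.1 h6
      omega
    · have : ¬ i' < Y.colLen j := fun h => absurd (h5.2 h) (by omega)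
      omega
  · rintro ⟨b, hb, hpb, hnb⟩
    obtain ⟨i, hi, rfl⟩ := mem_betaSet.1 hb
    rw [mem_betaSet] at hnb
    push Not at hnb
    set y := Y.rowLen i + (N - 1 - i) - p with hy
    -- the number of beads above the gap `y`
    obtain ⟨t, ht1, ht2, ht3⟩ : ∃ t ≤ N, (∀ s < t, y < Y.rowLen s + (N - 1 - s)) ∧
        (t < N → Y.rowLen t + (N - 1 - t) < y) := by
      have hex : ∃ t, t = N ∨ Y.rowLen t + (N - 1 - t) < y := ⟨N, Or.inl rfl⟩
      refine ⟨Nat.find hex, Nat.find_min' hex (Or.inl rfl), fun s hs => ?_, fun h => ?_⟩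
      · have h1 := Nat.find_min hex hs
        push Not at h1
        have h2 : s < N := lt_of_lt_of_le hs (Nat.find_min' hex (Or.inl rfl))
        have h3 := hnb s h2
        omega
      · exact (Nat.find_spec hex).resolve_left h.ne
    have hge : N ≤ y + t := by
      rcases lt_or_ge t N with h | h
      · have := ht3 h
        omega
      · omega
    -- N - t beads lie below y, so y - (N - t) gaps do; this number is the column of the hook, and
    -- the t rows with beads above y are those that reach it.
    have hcl : Y.colLen (y + t - N) = t := by
      apply le_antisymm
      · by_contra hcon
        have h1 := (hiff t (y + t - N)).2 (by omega)
        rcases lt_or_ge t N with h | h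
        · have := ht3 h
          omega
        · rw [rowLen_eq_zero (hN.trans h)] at h1
          omega
      · rcases Nat.eq_zero_or_pos t with h | h
        · omega
        · have h1 := ht2 (t - 1) (by omega)
          have h2 := (hiff (t - 1) (y + t - N)).1 (by omega)
          omega
    have hit : i < t := by
      by_contra hcon
      have h1 := Y.rowLen_anti t i (by omega)
      have h2 := ht3 (by omega)
      omega
    have h1 := (hiff i (y + t - N)).2 (by omega)
    refine ⟨(i, y + t - N), YoungDiagram.mem_iff_lt_rowLen.2 h1, ?_⟩
    rw [hookLength]
    dsimp only
    rw [hcl]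
    omega

end BetaSets

/-! ### Partitions and cores as bead sets -/

section PartitionsAndBeads

theorem rowLens_youngDiagram {n : ℕ} (lam : n.Partition) :
    (youngDiagram lam).rowLens = lam.parts.sort (· ≥ ·) :=
  YoungDiagram.rowLens_ofRowLens_eq_self fun _ hx => lam.parts_pos ((Multiset.mem_sort _).1 hx)

theorem sum_rowLens_youngDiagram {n : ℕ} (lam : n.Partition) :
    (youngDiagram lam).rowLens.sum = n := by
  rw [rowLens_youngDiagram, ← Multiset.sum_coe, Multiset.sort_eq, lam.parts_sum]

theorem youngDiagram_injective (n : ℕ) :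
    Function.Injective (youngDiagram : n.Partition → YoungDiagram) := by
  intro lam lam' h
  apply Nat.Partition.ext
  rw [← Multiset.sort_eq lam.parts (· ≥ ·), ← rowLens_youngDiagram, h, rowLens_youngDiagram,
    Multiset.sort_eq]

theorem exists_youngDiagram_eq {n : ℕ} {Y : YoungDiagram} (h : Y.rowLens.sum = n) :
    ∃ lam : n.Partition, youngDiagram lam = Y := by
  refine ⟨⟨(Y.rowLens : Multiset ℕ), fun {i} hi => Y.pos_of_mem_rowLens i hi, by simpa using h⟩, ?_⟩
  have h1 : (Y.rowLens : Multiset ℕ).sort (· ≥ ·) = Y.rowLens := by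
    rw [Multiset.coe_sort]
    exact List.mergeSort_eq_self _ (by simpa using Y.rowLens_sorted.pairwise)
  rw [youngDiagram]
  simp only [h1]
  exact YoungDiagram.ofRowLens_to_rowLens_eq_self

theorem colLen_youngDiagram_le {n : ℕ} (lam : n.Partition) : (youngDiagram lam).colLen 0 ≤ n := by
  rw [← YoungDiagram.length_rowLens, rowLens_youngDiagram, Multiset.length_sort]
  have f : lam.parts.card • 1 ≤ lam.parts.sum :=
    Multiset.card_nsmul_le_sum fun x hx => lam.parts_pos hx
  rwa [lam.parts_sum, smul_eq_mul, mul_one] at f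

/-- N ≥ n beads suffice because a partition of n has at most n rows. -/
theorem betaSet_youngDiagram_bijOn {n N : ℕ} (hN : n ≤ N) :
    Set.BijOn (fun lam : n.Partition => betaSet (youngDiagram lam) N) Set.univ (beads N n) := by
  have hcol : ∀ lam : n.Partition, (youngDiagram lam).colLen 0 ≤ N :=
    fun lam => (colLen_youngDiagram_le lam).trans hN
  refine ⟨fun lam _ => ?_, fun lam _ lam' _ h => ?_, fun S hS => ?_⟩
  · have := betaSet_mem_beads (hcol lam)
    rwa [sum_rowLens_youngDiagram] at this
  · exact youngDiagram_injective n (eq_of_betaSet_eq (hcol lam) (hcol lam') h)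
  · obtain ⟨Y, hY, hYS⟩ := exists_betaSet_eq S
    rw [Finset.mem_coe, mem_beads] at hS
    rw [hS.1] at hY hYS
    have h1 := (mem_beads.1 (betaSet_mem_beads hY)).2
    rw [hYS, hS.2] at h1
    obtain ⟨lam, hlam⟩ := exists_youngDiagram_eq (n := n) (Y := Y) (by omega)
    exact ⟨lam, Set.mem_univ _, by dsimp only; rw [hlam, hYS]⟩

theorem card_partition_eq_card_beads {n N : ℕ} (hN : n ≤ N) :
    Fintype.card n.Partition = (beads N n).card := by
  have h := betaSet_youngDiagram_bijOn hN
  exact Finset.card_bij (fun lam _ => betaSet (youngDiagram lam) N)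
    (fun lam _ => h.mapsTo (Set.mem_univ lam))
    (fun _ _ _ _ e => h.injOn (Set.mem_univ _) (Set.mem_univ _) e)
    fun S hS => by
      obtain ⟨lam, -, hlam⟩ := h.surjOn hS
      exact ⟨lam, Finset.mem_univ _, hlam⟩

theorem isCore_iff {p n N : ℕ} (hp : 0 < p) (hN : n ≤ N) (lam : n.Partition) :
    IsCore p lam ↔ ∀ b ∈ betaSet (youngDiagram lam) N, p ≤ b →
      b - p ∈ betaSet (youngDiagram lam) N := by
  have h := exists_hookLength_eq_iff ((colLen_youngDiagram_le lam).trans hN) hp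
  rw [IsCore, ← not_iff_not]
  push Not
  exact h

theorem coreCount_eq_card_filter {p n N : ℕ} (hp : 0 < p) (hN : n ≤ N) :
    coreCount p n = ((beads N n).filter fun S => ∀ b ∈ S, p ≤ b → b - p ∈ S).card := by
  classical
  have h := betaSet_youngDiagram_bijOn hN
  rw [coreCount]
  refine Finset.card_bij (fun lam _ => betaSet (youngDiagram lam) N) (fun lam hlam => ?_)
    (fun _ _ _ _ e => h.injOn (Set.mem_univ _) (Set.mem_univ _) e) fun S hS => ?_
  · rw [Finset.mem_filter] at hlam ⊢
    exact ⟨h.mapsTo (Set.mem_univ lam), (isCore_iff hp hN lam).1 hlam.2⟩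
  · rw [Finset.mem_filter] at hS
    obtain ⟨lam, -, rfl⟩ := h.surjOn hS.1
    exact ⟨lam, Finset.mem_filter.2 ⟨Finset.mem_univ _, (isCore_iff hp hN lam).2 hS.2⟩, rfl⟩

end PartitionsAndBeads

/-! ### The p-runner abacus: cores and quotients -/

section Runners

variable {p : ℕ}

/-- The bead set whose runners are the sets `T r`. -/
def glue (T : Fin p → Finset ℕ) : Finset ℕ :=
  (Finset.univ.sigma T).image fun x => p * x.2 + (x.1 : ℕ)

theorem mul_add_fin_inj {t t' : ℕ} {r r' : Fin p} (h : p * t + (r : ℕ) = p * t' + (r' : ℕ)) :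
    t = t' ∧ r = r' := by
  have hr := r.2
  have hr' := r'.2
  have h1 := congrArg (· % p) h
  have h2 := congrArg (· / p) h
  simp only [Nat.mul_add_mod, Nat.mod_eq_of_lt hr, Nat.mod_eq_of_lt hr'] at h1
  simp only [Nat.mul_add_div (by omega : 0 < p), Nat.div_eq_of_lt hr, Nat.div_eq_of_lt hr',
    add_zero] at h2
  exact ⟨h2, Fin.ext h1⟩

theorem mul_add_mem_glue {T : Fin p → Finset ℕ} {t : ℕ} {r : Fin p} :
    p * t + (r : ℕ) ∈ glue T ↔ t ∈ T r := by
  rw [glue, Finset.mem_image]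
  constructor
  · rintro ⟨⟨r', t'⟩, hx, h⟩
    obtain ⟨rfl, rfl⟩ := mul_add_fin_inj h
    exact (Finset.mem_sigma.1 hx).2
  · exact fun h => ⟨⟨r, t⟩, Finset.mem_sigma.2 ⟨Finset.mem_univ _, h⟩, rfl⟩

theorem glue_injective : Function.Injective (glue : (Fin p → Finset ℕ) → Finset ℕ) := by
  intro T T' h
  funext r
  ext t
  rw [← mul_add_mem_glue, h, mul_add_mem_glue]

theorem exists_eq_mul_add_fin (hp : 0 < p) (x : ℕ) : ∃ t, ∃ r : Fin p, x = p * t + (r : ℕ) :=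
  ⟨x / p, ⟨x % p, Nat.mod_lt _ hp⟩, (Nat.div_add_mod x p).symm⟩

theorem glue_surjective (hp : 0 < p) :
    Function.Surjective (glue : (Fin p → Finset ℕ) → Finset ℕ) := by
  intro S
  refine ⟨fun r => (S.filter fun x => x % p = r).image (· / p), ?_⟩
  ext x
  obtain ⟨t, r, rfl⟩ := exists_eq_mul_add_fin hp x
  rw [mul_add_mem_glue, Finset.mem_image]
  constructor
  · rintro ⟨x, hx, rfl⟩
    rw [Finset.mem_filter] at hx
    rw [← hx.2, Nat.div_add_mod]
    exact hx.1
  · intro h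
    refine ⟨_, Finset.mem_filter.2 ⟨h, ?_⟩, ?_⟩
    · rw [Nat.mul_add_mod, Nat.mod_eq_of_lt r.2]
    · rw [Nat.mul_add_div hp, Nat.div_eq_of_lt r.2, add_zero]

theorem sum_glue (T : Fin p → Finset ℕ) (f : ℕ → ℕ) :
    ∑ x ∈ glue T, f x = ∑ r, ∑ t ∈ T r, f (p * t + (r : ℕ)) := by
  rw [glue, Finset.sum_image, Finset.sum_sigma]
  rintro ⟨r, t⟩ _ ⟨r', t'⟩ _ h
  obtain ⟨rfl, rfl⟩ := mul_add_fin_inj h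
  rfl

theorem card_glue (T : Fin p → Finset ℕ) : (glue T).card = ∑ r, (T r).card := by
  simp only [Finset.card_eq_sum_ones]
  exact sum_glue T fun _ => 1

theorem sum_id_glue (T : Fin p → Finset ℕ) :
    ∑ x ∈ glue T, x = ∑ r, (p * ∑ t ∈ T r, t + r * (T r).card) := by
  rw [sum_glue T fun x => x]
  refine Finset.sum_congr rfl fun r _ => ?_
  rw [Finset.sum_add_distrib, Finset.mul_sum, Finset.sum_const, smul_eq_mul, mul_comm (T r).card]

/-- The bead counts `ν` on the `p` runners for which the pushed up bead configuration has energy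
`m`. -/
def coreCharges (p N m : ℕ) : Finset (Fin p → ℕ) :=
  (Finset.piAntidiag Finset.univ N).filter fun ν =>
    glue (fun r => Finset.range (ν r)) ∈ beads N m

theorem mem_coreCharges {N m : ℕ} {ν : Fin p → ℕ} :
    ν ∈ coreCharges p N m ↔ glue (fun r => Finset.range (ν r)) ∈ beads N m := by
  rw [coreCharges, Finset.mem_filter, Finset.mem_piAntidiag]
  refine ⟨fun h => h.2, fun h => ⟨⟨?_, by simp⟩, h⟩⟩
  have := (mem_beads.1 h).1
  rw [card_glue] at this
  simpa using this

theorem eq_range_of_closed {T : Finset ℕ} (h : ∀ t, t + 1 ∈ T → t ∈ T) :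
    T = Finset.range T.card := by
  have hdown : ∀ d t, t + d ∈ T → t ∈ T := by
    intro d
    induction d with
    | zero => exact fun t ht => ht
    | succ d ih => exact fun t ht => ih t (h _ ht)
  refine Finset.eq_of_subset_of_card_le (fun t ht => ?_) (by simp)
  have hsub : Finset.range (t + 1) ⊆ T := fun s hs => by
    rw [Finset.mem_range] at hs
    exact hdown (t - s) s (by rwa [show s + (t - s) = t by omega])
  have := Finset.card_le_card hsub
  rw [Finset.card_range] at this
  exact Finset.mem_range.2 this

/-- Moving a bead down by p is moving it one place down its runner, so no move is possible exactly
when every runner is an initial segment. -/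
theorem glue_closed_iff (T : Fin p → Finset ℕ) (hp : 0 < p) :
    (∀ b ∈ glue T, p ≤ b → b - p ∈ glue T) ↔ T = fun r => Finset.range (T r).card := by
  constructor
  · intro h
    funext r
    refine eq_range_of_closed fun t ht => ?_
    have h1 := h _ (mul_add_mem_glue.2 ht) (by nlinarith)
    rwa [show p * (t + 1) + (r : ℕ) - p = p * t + r by rw [mul_add, mul_one]; omega,
      mul_add_mem_glue] at h1
  · intro h b hb hpb
    obtain ⟨t, r, rfl⟩ := exists_eq_mul_add_fin hp b
    rw [mul_add_mem_glue, h] at hb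
    obtain ⟨t, rfl⟩ : ∃ s, t = s + 1 := by
      cases t with
      | zero => have := r.2; omega
      | succ s => exact ⟨s, rfl⟩
    rw [show p * (t + 1) + (r : ℕ) - p = p * t + r by rw [mul_add, mul_one]; omega,
      mul_add_mem_glue, h]
    rw [Finset.mem_range] at hb ⊢
    omega

theorem coreCount_eq_card_coreCharges {m N : ℕ} (hp : 0 < p) (hN : m ≤ N) :
    coreCount p m = (coreCharges p N m).card := by
  rw [coreCount_eq_card_filter hp hN]
  symm
  refine Finset.card_bij (fun ν _ => glue fun r => Finset.range (ν r)) ?_ ?_ ?_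
  · intro ν hν
    refine Finset.mem_filter.2 ⟨mem_coreCharges.1 hν, (glue_closed_iff _ hp).2 ?_⟩
    simp
  · intro ν _ ν' _ h
    funext r
    have := congrArg Finset.card (congrFun (glue_injective h) r)
    simpa using this
  · intro S hS
    rw [Finset.mem_filter] at hS
    obtain ⟨T, rfl⟩ := glue_surjective hp S
    have h := (glue_closed_iff T hp).1 hS.2
    refine ⟨fun r => (T r).card, ?_, ?_⟩
    · rw [mem_coreCharges, ← h]
      exact hS.1
    · dsimp only
      rw [← h]

/-- Position p ν_r + r is a gap, whereas all positions below N - m are occupied. -/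
theorem le_of_mem_coreCharges {N m n : ℕ} {ν : Fin p → ℕ} (h : ν ∈ coreCharges p N m)
    (hN : p * n + m ≤ N) (r : Fin p) : n ≤ ν r := by
  by_contra hcon
  have h1 : p * (ν r + 1) ≤ p * n := Nat.mul_le_mul_left _ (by omega)
  have hr := r.2
  rw [mul_add, mul_one] at h1
  have h2 := mem_of_mem_beads (mem_coreCharges.1 h) (y := p * ν r + r) (by omega)
  rw [mul_add_mem_glue (T := fun r => Finset.range (ν r))] at h2
  simp at h2

/-- A bead set is cut into its runners T_r, with ν_r beads and energy e_r. Packing every runner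
leaves the core and lowers the energy by p ∑ e_r, so d = ∑ e_r. -/
theorem card_beads_eq_sum (hp : 0 < p) (N n : ℕ) :
    (beads N n).card = ∑ d ∈ Finset.range (n / p + 1), ∑ ν ∈ coreCharges p N (n - p * d),
      ∑ e ∈ Finset.finsuppAntidiag (Finset.univ : Finset (Fin p)) d,
        ∏ r, (beads (ν r) (e r)).card := by
  have hsum : ∀ (ν : Fin p → ℕ) (e : Fin p → ℕ) (T : Fin p → Finset ℕ),
      (∀ r, T r ∈ beads (ν r) (e r)) → ∑ x ∈ glue T, x
        = p * (∑ r, e r) + ∑ x ∈ glue (fun r => Finset.range (ν r)), x := by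
    intro ν e T hT
    rw [sum_id_glue, sum_id_glue, Finset.mul_sum, ← Finset.sum_add_distrib]
    refine Finset.sum_congr rfl fun r _ => ?_
    rw [(mem_beads.1 (hT r)).1, (mem_beads.1 (hT r)).2, Finset.card_range]
    ring
  have hcard : ∀ (ν : Fin p → ℕ) (e : Fin p → ℕ) (T : Fin p → Finset ℕ),
      (∀ r, T r ∈ beads (ν r) (e r)) →
        (glue T).card = (glue (fun r => Finset.range (ν r))).card := by
    intro ν e T hT
    rw [card_glue, card_glue]
    refine Finset.sum_congr rfl fun r _ => ?_
    rw [(mem_beads.1 (hT r)).1, Finset.card_range]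
  have hpi : ∀ (ν : Fin p → ℕ) (e : Fin p →₀ ℕ), ∏ r, (beads (ν r) (e r)).card
      = (Fintype.piFinset fun r => beads (ν r) (e r)).card := fun ν e =>
    (Fintype.card_piFinset _).symm
  simp only [hpi, ← Finset.card_sigma]
  symm
  refine Finset.card_bij (fun x _ => glue x.2.2.2) ?_ ?_ ?_
  · rintro ⟨d, ν, e, T⟩ hx
    simp only [Finset.mem_sigma, Finset.mem_range, Finset.mem_finsuppAntidiag,
      Fintype.mem_piFinset] at hx
    obtain ⟨hd, hν, ⟨he, -⟩, hT⟩ := hx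
    have hν' := mem_beads.1 (mem_coreCharges.1 hν)
    have hpd : p * d ≤ n := (Nat.mul_le_mul_left p (by omega : d ≤ n / p)).trans
      (Nat.mul_div_le n p)
    rw [mem_beads]
    dsimp only
    rw [hsum ν e T hT, hcard ν e T hT, hν'.1, hν'.2, he]
    exact ⟨rfl, by omega⟩
  · rintro ⟨d, ν, e, T⟩ hx ⟨d', ν', e', T'⟩ hx' h
    simp only [Finset.mem_sigma, Finset.mem_range, Finset.mem_finsuppAntidiag,
      Fintype.mem_piFinset] at hx hx'
    obtain rfl : T = T' := glue_injective h
    obtain ⟨-, -, ⟨he, -⟩, hT⟩ := hx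
    obtain ⟨-, -, ⟨he', -⟩, hT'⟩ := hx'
    obtain rfl : ν = ν' := by
      funext r
      rw [← (mem_beads.1 (hT r)).1, ← (mem_beads.1 (hT' r)).1]
    obtain rfl : e = e' := by
      ext r
      have h1 := (mem_beads.1 (hT r)).2
      have h2 := (mem_beads.1 (hT' r)).2
      omega
    obtain rfl : d = d' := he.symm.trans he'
    rfl
  · intro S hS
    obtain ⟨T, rfl⟩ := glue_surjective hp S
    obtain ⟨hS1, hS2⟩ := mem_beads.1 hS
    set ν : Fin p → ℕ := fun r => (T r).card with hν
    set e : Fin p → ℕ := fun r => ∑ t ∈ T r, t - ∑ t ∈ Finset.range (T r).card, t with he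
    have hT : ∀ r, T r ∈ beads (ν r) (e r) := fun r =>
      mem_beads.2 ⟨rfl, (Nat.sub_add_cancel (sum_range_card_le (T r))).symm⟩
    have h1 := hsum ν e T hT
    have h2 := hcard ν e T hT
    have h3 := sum_range_card_le (glue fun r => Finset.range (ν r))
    rw [hS1] at h2
    rw [← h2] at h3
    rw [hS2] at h1
    have hpd : p * ∑ r, e r ≤ n := by omega
    refine ⟨⟨∑ r, e r, ν, Finsupp.equivFunOnFinite.symm e, T⟩, ?_, rfl⟩
    simp only [Finset.mem_sigma, Finset.mem_range, Finset.mem_finsuppAntidiag,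
      Fintype.mem_piFinset]
    refine ⟨?_, mem_coreCharges.2 (mem_beads.2 ⟨h2.symm, by omega⟩), ⟨by simp, by simp⟩, hT⟩
    rw [Nat.lt_succ_iff, Nat.le_div_iff_mul_le hp]
    linarith

/-- Partitions are counted by `p`-cores and `p`-quotients. -/
theorem card_partition_eq_sum_coreCount (hp : 0 < p) (n : ℕ) :
    Fintype.card n.Partition = ∑ d ∈ Finset.range (n / p + 1), coreCount p (n - p * d) *
      ∑ e ∈ Finset.finsuppAntidiag (Finset.univ : Finset (Fin p)) d,
        ∏ r, Fintype.card (e r).Partition := by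
  -- With this many beads every runner of the core carries at least n ≥ e_r beads, so bead sets on a
  -- runner count all partitions of e_r.
  rw [card_partition_eq_card_beads (N := p * n + n) (by omega), card_beads_eq_sum hp]
  refine Finset.sum_congr rfl fun d hd => ?_
  rw [coreCount_eq_card_coreCharges (N := p * n + n) hp (by omega)]
  refine Finset.sum_const_nat fun ν hν => Finset.sum_congr rfl fun e he =>
    Finset.prod_congr rfl fun r _ => ?_
  refine (card_partition_eq_card_beads ?_).symm
  have h1 := le_of_mem_coreCharges hν (n := n) (by omega) r
  have h2 : e r ≤ d := by
    rw [← (Finset.mem_finsuppAntidiag.1 he).1]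
    exact Finset.single_le_sum (f := e) (fun _ _ => Nat.zero_le _) (Finset.mem_univ r)
  have h3 : d ≤ n / p := Nat.lt_succ_iff.1 (Finset.mem_range.1 hd)
  have h4 : n / p ≤ n := Nat.div_le_self _ _
  omega

end Runners

/-! ### The core series and the comparison of generating functions -/

section CoreSeries

open PowerSeries hiding X

/-- The generating function of the `p`-cores. -/
noncomputable def coreSeries (p : ℕ) : ℚ⟦X⟧ := PowerSeries.mk fun n => (coreCount p n : ℚ)

theorem coeff_mul_expand {p : ℕ} (hp : p ≠ 0) (f g : ℚ⟦X⟧) (n : ℕ) :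
    PowerSeries.coeff n (f * PowerSeries.expand p hp g) =
      ∑ d ∈ Finset.range (n / p + 1), PowerSeries.coeff (n - p * d) f * PowerSeries.coeff d g := by
  rw [mul_comm, PowerSeries.coeff_mul, Finset.Nat.sum_antidiagonal_eq_sum_range_succ
    (fun a b => PowerSeries.coeff a (PowerSeries.expand p hp g) * PowerSeries.coeff b f)]
  have hinj : Set.InjOn (p * ·) (Finset.range (n / p + 1) : Set ℕ) :=
    (mul_right_injective₀ hp).injOn
  rw [← Finset.sum_subset (s₁ := (Finset.range (n / p + 1)).image (p * ·)),
    Finset.sum_image hinj]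
  · refine Finset.sum_congr rfl fun d _ => ?_
    rw [PowerSeries.coeff_expand_mul, mul_comm]
  · intro x hx
    obtain ⟨d, hd, rfl⟩ := Finset.mem_image.1 hx
    rw [Finset.mem_range, Nat.lt_succ_iff] at hd ⊢
    exact (Nat.mul_le_mul_left p hd).trans (Nat.mul_div_le n p)
  · intro x hx hx'
    rw [PowerSeries.coeff_expand_of_not_dvd, zero_mul]
    rintro ⟨d, rfl⟩
    refine hx' (Finset.mem_image.2 ⟨d, ?_, rfl⟩)
    rw [Finset.mem_range, Nat.lt_succ_iff] at hx ⊢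
    exact (Nat.le_div_iff_mul_le (Nat.pos_of_ne_zero hp)).2 (by linarith)

theorem partitionSeries_eq_coreSeries_mul {p : ℕ} (hp : p ≠ 0) :
    partitionSeries = coreSeries p * PowerSeries.expand p hp (partitionSeries ^ p) := by
  ext n
  rw [coeff_mul_expand, partitionSeries, PowerSeries.coeff_mk,
    card_partition_eq_sum_coreCount (Nat.pos_of_ne_zero hp)]
  push_cast
  refine Finset.sum_congr rfl fun d _ => ?_
  rw [coreSeries, PowerSeries.coeff_mk]
  congr 1
  have h : (PowerSeries.mk fun n => (Fintype.card n.Partition : ℚ)) ^ p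
      = ∏ _ : Fin p, PowerSeries.mk fun n => (Fintype.card n.Partition : ℚ) := by simp
  rw [h, PowerSeries.coeff_prod]
  simp only [PowerSeries.coeff_mk]

theorem partitionSeries_ne_zero : partitionSeries ≠ 0 := by
  intro h
  have := congrArg (PowerSeries.coeff 0) h
  simp [partitionSeries] at this

/-- After multiplication by (1 - x^(pj)) P(x^p), both sides become x^(pj) P(x), through the core
factorisation on the left and the class regular one on the right. -/
theorem coreSeries_mul_expand_tsuchiokaSeries {p : ℕ} (hp : 2 ≤ p) {j : ℕ} (hj : j ≠ 0) :
    coreSeries p * PowerSeries.expand p (by omega) (tsuchiokaSeries p j)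
      = PowerSeries.mk fun n => (glaisherTotal p j n : ℚ) := by
  have hp0 : p ≠ 0 := by omega
  have h1 := congrArg (PowerSeries.expand p hp0) (tsuchiokaSeries_mul_one_sub hp hj)
  simp only [map_mul, map_sub, map_one, map_pow, PowerSeries.expand_X, ← pow_mul] at h1
  have h2 := mk_glaisherTotal_mul_one_sub hp hj
  have h3 := partitionSeries_eq_classRegularSeries_mul p hp0
  have h4 := partitionSeries_eq_coreSeries_mul hp0
  have h5 : partitionSeries ^ p = partitionSeries ^ (p - 1) * partitionSeries := by
    rw [← pow_succ, Nat.sub_add_cancel (by omega)]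
  rw [h5, map_mul, map_pow] at h4
  have h6 : PowerSeries.expand p hp0 partitionSeries ≠ 0 := fun h =>
    partitionSeries_ne_zero (by rw [h3, h, mul_zero])
  have h7 : (1 : ℚ⟦X⟧) - PowerSeries.X ^ (p * j) ≠ 0 :=
    right_ne_zero_of_mul_eq_one (geomSeries_mul_one_sub _ (mul_ne_zero hp0 hj))
  refine mul_right_cancel₀ (mul_ne_zero h7 h6) ?_
  linear_combination coreSeries p * PowerSeries.expand p hp0 partitionSeries * h1
    - PowerSeries.expand p hp0 partitionSeries * h2
    + PowerSeries.X ^ (p * j) * h3 - PowerSeries.X ^ (p * j) * h4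

end CoreSeries

/-! ### Comparison of exponents in Δ -/

section Delta

theorem sum_tsuchiokaA_mul_coreCount {p : ℕ} (hp : 2 ≤ p) {j : ℕ} (hj : j ≠ 0) (n : ℕ) :
    ∑ d ∈ Finset.range (n / p + 1), ⌊tsuchiokaA p j d⌋₊ * coreCount p (n - p * d)
      = glaisherTotal p j n := by
  have h := congrArg (PowerSeries.coeff n) (coreSeries_mul_expand_tsuchiokaSeries hp hj)
  rw [coeff_mul_expand, PowerSeries.coeff_mk] at h
  rw [← Nat.cast_inj (R := ℚ), ← h]
  push_cast
  refine Finset.sum_congr rfl fun d _ => ?_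
  rw [floor_tsuchiokaA hp, mul_comm, tsuchiokaSeries, coreSeries, PowerSeries.coeff_mk,
    PowerSeries.coeff_mk]

theorem tsuchiokaA_eq_zero {p j d : ℕ} (h : d < j) : tsuchiokaA p j d = 0 := by
  refine Finset.sum_eq_zero fun lam _ => ?_
  have : mult lam j = 0 := Multiset.count_eq_zero.2 fun hm => by
    have := lam.le_of_mem_parts hm
    omega
  simp [this]

/-- A common range of j for all d allows the products over d and j to be exchanged. -/
theorem blockDelta_eq {p d n : ℕ} (h : d ≤ n) :
    blockDelta p d = ∏ j ∈ Finset.Icc 1 n, qInt p j ^ ⌊tsuchiokaA p j d⌋₊ := by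
  refine Finset.prod_subset (Finset.Icc_subset_Icc_right h) fun j hj hj' => ?_
  rw [Finset.mem_Icc] at hj hj'
  rw [tsuchiokaA_eq_zero (by omega), Nat.floor_zero, pow_zero]

theorem delta_eq_prod_wG {p : ℕ} (hp : 2 ≤ p) (n : ℕ) :
    delta p n = ∏ lam ∈ classRegular p n, wG p lam := by
  have h1 : delta p n = ∏ j ∈ Finset.Icc 1 n, qInt p j ^ glaisherTotal p j n := by
    have h2 : ∀ d ∈ Finset.range (n / p + 1), blockDelta p d ^ coreCount p (n - p * d)
        = ∏ j ∈ Finset.Icc 1 n, qInt p j ^ (⌊tsuchiokaA p j d⌋₊ * coreCount p (n - p * d)) := by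
      intro d hd
      have h3 : d ≤ n / p := Nat.lt_succ_iff.1 (Finset.mem_range.1 hd)
      rw [blockDelta_eq (h3.trans (Nat.div_le_self _ _)), ← Finset.prod_pow]
      simp only [pow_mul]
    rw [delta, Finset.prod_congr rfl h2, Finset.prod_comm]
    refine Finset.prod_congr rfl fun j hj => ?_
    rw [Finset.prod_pow_eq_pow_sum, sum_tsuchiokaA_mul_coreCount hp]
    have := (Finset.mem_Icc.1 hj).1
    omega
  rw [h1]
  simp only [wG]
  rw [Finset.prod_comm]
  exact Finset.prod_congr rfl fun j _ => (Finset.prod_pow_eq_pow_sum _ _ _).symm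

end Delta

end GradedCartan

theorem theorem4p1 (p n : ℕ) (hp : 2 ≤ p) :
    -- the equalities of polynomials in `q`
    GradedCartan.delta p n = ∏ lam ∈ GradedCartan.classRegular p n, GradedCartan.wG p lam ∧
    ∏ lam ∈ GradedCartan.classRegular p n, GradedCartan.wG p lam
      = ∏ lam ∈ GradedCartan.classRegular p n, GradedCartan.wE p lam ∧
    -- both products are products of labels over the labelled diagrams
    ∏ lam ∈ GradedCartan.classRegular p n, GradedCartan.wG p lam
      = ∏ᶠ c : GradedCartan.Box p n, GradedCartan.qInt p c.G ∧
    ∏ lam ∈ GradedCartan.classRegular p n, GradedCartan.wE p lam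
      = ∏ᶠ c : GradedCartan.Box p n, GradedCartan.qInt p c.E ∧
    -- the involution `θ`, which interchanges `i` with `i'` and `j` with `j'`
    ∃ θ : GradedCartan.Box p n → GradedCartan.Box p n,
      Function.Involutive θ ∧
      GradedCartan.Box.E ∘ θ = GradedCartan.Box.G ∧
      ∀ c : GradedCartan.Box p n,
        c.k = (θ c).i * p ^ (c.j + (θ c).j) ∧
        (θ c).k = c.i * p ^ (c.j + (θ c).j) ∧
        ∃ μ : Multiset ℕ,
          c.lam.parts = μ + Multiset.replicate (p * c.k) c.i ∧
          (θ c).lam.parts = μ + Multiset.replicate (p * (θ c).k) (θ c).i := by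
  refine ⟨GradedCartan.delta_eq_prod_wG hp n, ?_, GradedCartan.prod_wG_eq_finprod hp n,
    GradedCartan.prod_wE_eq_finprod hp n, GradedCartan.Box.theta hp,
    GradedCartan.Box.theta_involutive hp, funext fun c => c.E_theta hp, fun c => c.theta_spec hp⟩
  rw [GradedCartan.prod_wG_eq_finprod hp, GradedCartan.prod_wE_eq_finprod hp,
    GradedCartan.finprod_G_eq_finprod_E hp]
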